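/- Notation: for $K\subset\mathbb R^n$ and $z\in\mathbb R^n$ let $K^z=\{y\in\mathbb R^n:\langle y-z,x-z\rangle\le 1\text{ for all }x\in K\}$ and $K^\circ=K^0$; $|\cdot|$ denotes $n$-dimensional Lebesgue measure, and $\mathrm{conv}(A,0)$ is the convex hull of $A\cup\{0\}$. The volume product of a convex body $K$ is $\mathcal P(K)=\inf\{|K||K^z| : z\in\mathrm{int}\,K\}$, and the Santaló point of $K$ is the unique $s\in\mathrm{int}\,K$ with $|K^s|=\min_{z\in\mathrm{int}\,K}|K^z|$. A polytope is simplicial if all its facets are simplices. Theorem. Let $n\ge 1$ and $m\ge n+1$, and let $K\subset\mathbb R^n$ be a polytope of maximal volume product among all polytopes in $\mathbb R^n$ with non-empty interior and at most $m$ vertices. Then $K$ is simplicial. If moreover the Santaló point of $K$ is the origin, then every vertex $x$ of $K$ satisfies $$|K^\circ|\sum_{F\ni x}|\mathrm{conv}(F,0)| = n\,|K|\,|\mathrm{conv}(F_x,0)|,$$ where the sum is over the facets $F$ of $K$ that contain $x$ and $F_x=\{y\in K^\circ:\langle y,x\rangle=1\}$ is the facet of $K^\circ$ corresponding to $x$.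 -/

import Mathlib

open MeasureTheory

namespace VolProd

/-- The polar body `K^z` of `K` with center of polarity `z`; `polarBody K 0` is `K°`. -/
def polarBody {n : ℕ} (K : Set (EuclideanSpace ℝ (Fin n))) (z : EuclideanSpace ℝ (Fin n)) :
    Set (EuclideanSpace ℝ (Fin n)) :=
  {y | ∀ x ∈ K, inner ℝ (y - z) (x - z) ≤ 1}

/-- The volume product `inf {|K| |K^z| : z ∈ int K}`, an infimum in `[0, ∞]`. -/
noncomputable def volumeProduct {n : ℕ} (K : Set (EuclideanSpace ℝ (Fin n))) : ENNReal :=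
  ⨅ z ∈ interior K, volume K * volume (polarBody K z)

/-- `s` is the Santaló point of `K`: a point of the interior of `K` at which `z ↦ |K^z|` attains
its minimum over the interior (for a convex body there is exactly one such point). -/
def IsSantaloPoint {n : ℕ} (K : Set (EuclideanSpace ℝ (Fin n)))
    (s : EuclideanSpace ℝ (Fin n)) : Prop :=
  s ∈ interior K ∧ ∀ z ∈ interior K, volume (polarBody K s) ≤ volume (polarBody K z)

/-- A polytope: the convex hull of a finite set of points. -/
def IsPolytope {n : ℕ} (K : Set (EuclideanSpace ℝ (Fin n))) : Prop :=
  ∃ S : Set (EuclideanSpace ℝ (Fin n)), S.Finite ∧ K = convexHull ℝ S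

/-- The vertices of a polytope are its extreme points. -/
def vertices {n : ℕ} (K : Set (EuclideanSpace ℝ (Fin n))) : Set (EuclideanSpace ℝ (Fin n)) :=
  Set.extremePoints ℝ K

/-- The class of polytopes in `ℝⁿ` with non-empty interior and at most `m` vertices. -/
def polytopesAtMost (n m : ℕ) : Set (Set (EuclideanSpace ℝ (Fin n))) :=
  {K | IsPolytope K ∧ (interior K).Nonempty ∧ (vertices K).encard ≤ m}

/-- `F` is a facet of `K`: a non-empty face (the set of maximizers on `K` of a linear functional)
of dimension `n - 1`. -/
def IsFacet {n : ℕ} (K F : Set (EuclideanSpace ℝ (Fin n))) : Prop :=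
  F.Nonempty ∧ IsExposed ℝ K F ∧ Module.finrank ℝ (vectorSpan ℝ F) + 1 = n

/-- `F` is a simplex: the convex hull of finitely many affinely independent points
(at least one point). -/
def IsSimplex {n : ℕ} (F : Set (EuclideanSpace ℝ (Fin n))) : Prop :=
  ∃ (k : ℕ) (T : Affine.Simplex ℝ (EuclideanSpace ℝ (Fin n)) k), F = convexHull ℝ (Set.range T.points)

/-- A simplicial polytope: every facet is a simplex. -/
def IsSimplicialPolytope {n : ℕ} (K : Set (EuclideanSpace ℝ (Fin n))) : Prop :=
  IsPolytope K ∧ ∀ F, IsFacet K F → IsSimplex F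

/-- The facet `F_x = {y ∈ K° : ⟨y, x⟩ = 1}` of `K°` that corresponds to the vertex `x` of `K`. -/
def dualFacet {n : ℕ} (K : Set (EuclideanSpace ℝ (Fin n))) (x : EuclideanSpace ℝ (Fin n)) :
    Set (EuclideanSpace ℝ (Fin n)) :=
  {y ∈ polarBody K 0 | inner ℝ y x = 1}

/-- `K` has maximal volume product among the polytopes in `ℝⁿ` with non-empty interior and at most
`m` vertices. -/
def IsMaximalPolytope {n : ℕ} (m : ℕ) (K : Set (EuclideanSpace ℝ (Fin n))) : Prop :=
  K ∈ polytopesAtMost n m ∧ ∀ L ∈ polytopesAtMost n m, volumeProduct L ≤ volumeProduct K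

/-- The volume of `conv(F, 0)`. (For compact `F`, as below, the convex hull is closed.) -/
noncomputable def coneVolume {n : ℕ} (F : Set (EuclideanSpace ℝ (Fin n))) : ENNReal :=
  volume (convexHull ℝ (insert 0 F))

end VolProd

/-!
Let `K` be a polytope of maximal volume product whose Santaló point is the origin. The proof moves one
vertex `x` radially: `K_t` is the convex hull of `(1 + t) x` and of the other vertices (`radialMove`).
It has at most as many vertices as `K`, so `𝒫(K_t) ≤ 𝒫(K) = |K| |K°|` for small `t` of both signs.

The infimum over the centre in `𝒫(K_t)` is harmless. The projective map `y ↦ y / (1 - ⟨z, y⟩)` gives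
`|L^z| = ∫_{L°} (1 - ⟨z, y⟩)^{-(n + 1)} dy` (`volume_polarBody_eq_lintegral`), which is at least
`|L°| + (n + 1) ∫_{L°} ⟨z, y⟩ dy + c ‖z‖²`. For `L = K` the first moments vanish, because the origin is
the Santaló point; for `L = K_t` they are therefore `O(t)`, and `|K_t^z| ≥ |K_t°| - O(t²)` for all `z`
(`exists_quadratic_defect`). The body `K_t°` arises from `K°` by shifting the hyperplane of the facet
`F_x` from the level `1` to `(1 + t)⁻¹`. Comparing with homothetic copies of a pyramid over `F_x`, whose
apex `q` lies beyond the hyperplane, gives `|K_t°| ≥ |K°| - n |conv(F_x, 0)| t - O(t²)`. Together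
(`IsMaximalPolytope.exists_mul_le`):
`|K_t| (|K°| - n |conv(F_x, 0)| t - O(t²)) ≤ |K| |K°|` for `t` of both signs.

*Facets are simplices.* Suppose that `x` lies in the span of the other vertices of a facet `F ∋ x`. Then
these vertices still span a set of dimension `n - 1`. The volume of `K_t` is computed from chords in the
direction `x` by Cavalieri's principle. An endpoint that is a convex combination of the vertices with
coefficient `c` at `x` moves by at least `c t`. Hence the chords for `t` and `-t` together are at least
twice the original chord, and near a relative interior point of the hull of the other vertices of `F`
there is a strict gain, since both a positive coefficient and the coefficient `0` can be used there
(`exists_kink`): `|K_t| + |K_{-t}| ≥ 2 |K| + c t` with `c > 0`. Adding the inequalities above for `t`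
and `-t` yields a contradiction, so the vertices of each facet are linearly independent. For a general
maximal polytope, one translates the Santaló point, which exists by `exists_isSantaloPoint`, to the
origin.

*The identity.* `K` is, up to null sets, the disjoint union of the pyramids `conv(F, 0)` over its facets.
When the facets through `x` are simplices, moving `x` scales their pyramids by `1 + t` and keeps them
almost disjoint, so `|K_t| ≥ |K| + t ∑_{F ∋ x} |conv(F, 0)|` for `t` of both signs
(`volume_real_radialMove_ge`). Inserting this into the inequality above, the coefficient of `t` has to
vanish, which is the claim.
-/

namespace VolProd

open Set
open scoped RealInnerProductSpace Pointwise

/-! ### Polar bodies and the projective change of variables -/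

section

variable {n : ℕ} {K : Set (EuclideanSpace ℝ (Fin n))} {z : EuclideanSpace ℝ (Fin n)}

lemma mem_polarBody_zero {y : EuclideanSpace ℝ (Fin n)} :
    y ∈ polarBody K 0 ↔ ∀ x ∈ K, ⟪y, x⟫ ≤ 1 := by
  simp [polarBody]

lemma isClosed_polarBody (K : Set (EuclideanSpace ℝ (Fin n))) (z : EuclideanSpace ℝ (Fin n)) :
    IsClosed (polarBody K z) := by
  have : polarBody K z = ⋂ x ∈ K, {y | ⟪y - z, x - z⟫ ≤ 1} := by
    ext y; simp [polarBody]
  rw [this]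
  exact isClosed_biInter fun x _ => isClosed_le (by fun_prop) continuous_const

lemma polarBody_anti {L : Set (EuclideanSpace ℝ (Fin n))} (h : K ⊆ L) :
    polarBody L z ⊆ polarBody K z := fun _ hy x hx => hy x (h hx)

lemma zero_mem_polarBody_zero : (0 : EuclideanSpace ℝ (Fin n)) ∈ polarBody K 0 := by
  simp [polarBody]

lemma mem_polarBody_convexHull {S : Set (EuclideanSpace ℝ (Fin n))}
    {y : EuclideanSpace ℝ (Fin n)} :
    y ∈ polarBody (convexHull ℝ S) 0 ↔ ∀ x ∈ S, ⟪y, x⟫ ≤ 1 := by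
  rw [mem_polarBody_zero]
  refine ⟨fun h x hx => h x (subset_convexHull ℝ S hx), fun h => ?_⟩
  have hc : Convex ℝ {x : EuclideanSpace ℝ (Fin n) | ⟪y, x⟫ ≤ 1} :=
    convex_halfSpace_le (innerSL ℝ y).isLinear 1
  exact convexHull_min h hc

lemma convex_polarBody_zero : Convex ℝ (polarBody K 0) := by
  intro a ha b hb s t hs ht hst
  rw [mem_polarBody_zero] at *
  intro x hx
  rw [inner_add_left, inner_smul_left, inner_smul_left]
  simp only [conj_trivial]
  nlinarith [mul_le_mul_of_nonneg_left (ha x hx) hs, mul_le_mul_of_nonneg_left (hb x hx) ht]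

/-- If the ball of radius `r` lies in `K`, then `K°` lies in the ball of radius `1/r`. -/
lemma polarBody_subset_closedBall {r : ℝ} (hr : 0 < r) (h : Metric.closedBall 0 r ⊆ K) :
    polarBody K 0 ⊆ Metric.closedBall 0 r⁻¹ := by
  intro y hy
  rw [mem_closedBall_zero_iff]
  by_cases h0 : y = 0
  · simp [h0, hr.le]
  have hy0 : 0 < ‖y‖ := norm_pos_iff.2 h0
  have := mem_polarBody_zero.1 hy ((r / ‖y‖) • y) (h (by
    rw [mem_closedBall_zero_iff, norm_smul, Real.norm_of_nonneg (by positivity)]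
    field_simp; exact le_rfl))
  rw [inner_smul_right, real_inner_self_eq_norm_sq] at this
  rw [← one_div, le_div_iff₀ hr]
  have e : r / ‖y‖ * ‖y‖ ^ 2 = ‖y‖ * r := by field_simp
  linarith

lemma closedBall_subset_polarBody {R : ℝ} (hR : 0 < R) (h : K ⊆ Metric.closedBall 0 R) :
    Metric.closedBall 0 R⁻¹ ⊆ polarBody K 0 := by
  intro y hy
  rw [mem_polarBody_zero]
  intro x hx
  have h1 := mem_closedBall_zero_iff.1 hy
  have h2 := mem_closedBall_zero_iff.1 (h hx)
  calc ⟪y, x⟫ ≤ ‖y‖ * ‖x‖ := real_inner_le_norm _ _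
    _ ≤ R⁻¹ * R := by gcongr
    _ = 1 := inv_mul_cancel₀ hR.ne'

/-- Points of the interior can be pushed a little further away from the origin. -/
lemma exists_one_add_smul_mem (hz : z ∈ interior K) : ∃ ε > (0 : ℝ), (1 + ε) • z ∈ K := by
  have : Filter.Tendsto (fun ε : ℝ => (1 + ε) • z) (nhdsWithin 0 (Ioi 0)) (nhds ((1 + 0 : ℝ) • z)) :=
    (Continuous.tendsto (by fun_prop) 0).mono_left nhdsWithin_le_nhds
  rw [add_zero, one_smul] at this
  obtain ⟨ε, h1, h2⟩ := ((this.eventually (mem_interior_iff_mem_nhds.1 hz)).and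
    self_mem_nhdsWithin).exists
  exact ⟨ε, h2, h1⟩

lemma inner_lt_one_of_mem_polarBody (hz : z ∈ interior K) {y : EuclideanSpace ℝ (Fin n)}
    (hy : y ∈ polarBody K 0) : ⟪z, y⟫ < 1 := by
  obtain ⟨ε, hε, h⟩ := exists_one_add_smul_mem hz
  have := mem_polarBody_zero.1 hy _ h
  rw [inner_smul_right, real_inner_comm] at this
  by_contra! h1
  nlinarith

/-- The projective map `y ↦ y / (1 - ⟨z, y⟩)` carries `K°` onto `K^z - z`. -/
lemma image_polarBody_projective (h0 : (0 : EuclideanSpace ℝ (Fin n)) ∈ interior K)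
    (hz : z ∈ interior K) :
    (fun y => (1 - ⟪z, y⟫)⁻¹ • y) '' polarBody K 0 = (fun w => w + z) ⁻¹' polarBody K z := by
  ext w
  constructor
  · rintro ⟨y, hy, rfl⟩ x hx
    have hp : 0 < 1 - ⟪z, y⟫ := sub_pos.2 (inner_lt_one_of_mem_polarBody hz hy)
    have := mem_polarBody_zero.1 hy x hx
    simp only [add_sub_cancel_right]
    rw [inner_smul_left, inner_sub_right, conj_trivial, inv_mul_le_iff₀ hp,
      real_inner_comm z y]
    linarith
  · intro hw
    have hw' : ∀ x ∈ K, ⟪w, x - z⟫ ≤ 1 := fun x hx => by simpa using hw x hx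
    have hp : 0 < 1 + ⟪z, w⟫ := by
      -- `-ε • z ∈ K` for small `ε > 0`, so the value `⟪z, w⟫ = -1` is excluded
      have h1 := hw' 0 (interior_subset h0)
      rw [zero_sub, inner_neg_right, real_inner_comm] at h1
      rcases eq_or_lt_of_le h1 with h2 | h2
      swap
      · linarith
      exfalso
      have : Filter.Tendsto (fun ε : ℝ => -ε • z) (nhdsWithin 0 (Ioi 0)) (nhds (-(0 : ℝ) • z)) :=
        (Continuous.tendsto (by fun_prop) 0).mono_left nhdsWithin_le_nhds
      rw [neg_zero, zero_smul] at this
      obtain ⟨ε, h3, h4⟩ := ((this.eventually (mem_interior_iff_mem_nhds.1 h0)).and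
        self_mem_nhdsWithin).exists
      have h5 := hw' _ h3
      rw [inner_sub_right, inner_smul_right, real_inner_comm] at h5
      have h6 : 0 < ε := h4
      nlinarith
    refine ⟨(1 + ⟪z, w⟫)⁻¹ • w, ?_, ?_⟩
    · rw [mem_polarBody_zero]
      intro x hx
      have := hw' x hx
      rw [inner_sub_right, real_inner_comm z w] at this
      rw [inner_smul_left, conj_trivial, inv_mul_le_iff₀ hp]
      linarith
    · simp only
      rw [inner_smul_right, smul_smul]
      have : (1 - (1 + ⟪z, w⟫)⁻¹ * ⟪z, w⟫)⁻¹ * (1 + ⟪z, w⟫)⁻¹ = 1 := by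
        rw [← mul_inv]
        have : (1 - (1 + ⟪z, w⟫)⁻¹ * ⟪z, w⟫) * (1 + ⟪z, w⟫) = 1 := by
          field_simp; ring
        rw [this, inv_one]
      rw [this, one_smul]

/-- The Jacobian of `y ↦ c • y`, `c = (1 - ⟨z, y⟩)⁻¹`: the derivative is `c` times a transvection. -/
lemma det_fderiv_projective (c : ℝ) (z y : EuclideanSpace ℝ (Fin n)) (hc : c * (1 - ⟪z, y⟫) = 1) :
    (c • (ContinuousLinearMap.id ℝ (EuclideanSpace ℝ (Fin n))) +
      ((c ^ 2) • innerSL ℝ z).smulRight y).det = c ^ (n + 1) := by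
  have : ((c • (ContinuousLinearMap.id ℝ (EuclideanSpace ℝ (Fin n))) +
      ((c ^ 2) • innerSL ℝ z).smulRight y : EuclideanSpace ℝ (Fin n) →L[ℝ] EuclideanSpace ℝ (Fin n)) :
      EuclideanSpace ℝ (Fin n) →ₗ[ℝ] EuclideanSpace ℝ (Fin n)) =
      c • LinearMap.transvection ((innerSL ℝ z : EuclideanSpace ℝ (Fin n) →L[ℝ] ℝ) :
        EuclideanSpace ℝ (Fin n) →ₗ[ℝ] ℝ) (c • y) := by
    ext v : 1
    simp [LinearMap.transvection, smul_smul, pow_two]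
    ring_nf
  rw [ContinuousLinearMap.det, this, LinearMap.det_smul, LinearMap.transvection.det]
  simp only [finrank_euclideanSpace, Fintype.card_fin, ContinuousLinearMap.coe_coe, innerSL_apply_apply,
    inner_smul_right]
  rw [pow_succ]
  congr 1
  linarith

/-- The volume of `K^z` as an integral over `K°`: the Jacobian of `y ↦ y / (1 - ⟨z, y⟩)` is
`(1 - ⟨z, y⟩)^{-(n + 1)}`. -/
lemma volume_polarBody_eq_lintegral (h0 : (0 : EuclideanSpace ℝ (Fin n)) ∈ interior K)
    (hz : z ∈ interior K) :
    volume (polarBody K z) =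
      ∫⁻ y in polarBody K 0, ENNReal.ofReal ((1 - ⟪z, y⟫)⁻¹ ^ (n + 1)) := by
  have himg := image_polarBody_projective h0 hz
  have hpos : ∀ y ∈ polarBody K 0, 0 < 1 - ⟪z, y⟫ := fun y hy =>
    sub_pos.2 (inner_lt_one_of_mem_polarBody hz hy)
  rw [← measure_preimage_add_right volume z, ← himg]
  have hd : ∀ y ∈ polarBody K 0, HasFDerivWithinAt (fun y => (1 - ⟪z, y⟫)⁻¹ • y)
      ((1 - ⟪z, y⟫)⁻¹ • (ContinuousLinearMap.id ℝ (EuclideanSpace ℝ (Fin n))) +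
      (((1 - ⟪z, y⟫)⁻¹ ^ 2) • innerSL ℝ z).smulRight y) (polarBody K 0) y := by
    intro y hy
    have h1 : HasFDerivAt (fun y => 1 - ⟪z, y⟫) (-(innerSL ℝ z)) y := by
      simpa using ((innerSL ℝ z).hasFDerivAt (x := y)).const_sub 1
    have h2 := (hasDerivAt_inv (hpos y hy).ne').comp_hasFDerivAt y h1
    have h3 := h2.smul (hasFDerivAt_id (𝕜 := ℝ) y)
    refine HasFDerivAt.hasFDerivWithinAt ?_
    refine h3.congr_fderiv ?_
    simp [smul_neg, neg_smul]
  have hinj : InjOn (fun y => (1 - ⟪z, y⟫)⁻¹ • y) (polarBody K 0) := by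
    intro a ha b hb hab
    have pa := hpos a ha
    have pb := hpos b hb
    simp only at hab
    have h1 := congrArg (fun v => ⟪z, v⟫) hab
    simp only [inner_smul_right] at h1
    have h2 : ⟪z, a⟫ = ⟪z, b⟫ := by
      field_simp at h1
      linarith
    rw [h2] at hab
    exact smul_right_injective _ (inv_pos.2 pb).ne' hab
  have := lintegral_image_eq_lintegral_abs_det_fderiv_mul volume
    (isClosed_polarBody K 0).measurableSet hd hinj (fun _ => 1)
  rw [setLIntegral_one] at this
  rw [this]
  refine setLIntegral_congr_fun (isClosed_polarBody K 0).measurableSet fun y hy => ?_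
  simp only [mul_one]
  rw [det_fderiv_projective _ _ _ (inv_mul_cancel₀ (hpos y hy).ne'), abs_of_nonneg]
  have := hpos y hy
  positivity

end

/-! ### The volume of the polar body as a function of the centre -/

section

variable {n : ℕ} {K : Set (EuclideanSpace ℝ (Fin n))} {z : EuclideanSpace ℝ (Fin n)}

/-- The first-order Taylor polynomial of `(1 - s)^{-N}`, with a quadratic gain that is uniform on
`[-R, 1)`. -/
lemma one_add_mul_add_sq_le_inv_pow (N : ℕ) {R s : ℝ} (h1 : -R ≤ s) (h2 : s < 1) :
    1 + N * s + N / (1 + R) * s ^ 2 ≤ (1 - s)⁻¹ ^ N := by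
  have hp : 0 < 1 - s := by linarith
  have ha : s + s ^ 2 / (1 + R) ≤ (1 - s)⁻¹ - 1 := by
    have e : (1 - s)⁻¹ - 1 = s + s ^ 2 / (1 - s) := by field_simp; ring
    rw [e]
    gcongr
    linarith
  have hb := one_add_mul_le_pow (a := (1 - s)⁻¹ - 1)
    (by have : 0 < (1 - s)⁻¹ := inv_pos.2 hp
        linarith) N
  rw [add_sub_cancel] at hb
  have : (N : ℝ) * (s + s ^ 2 / (1 + R)) ≤ N * ((1 - s)⁻¹ - 1) := by gcongr
  calc 1 + N * s + N / (1 + R) * s ^ 2 = 1 + N * (s + s ^ 2 / (1 + R)) := by ring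
    _ ≤ _ := by linarith

lemma one_add_pow_le_quadratic (N : ℕ) {a : ℝ} (h : |a| ≤ 1) :
    (1 + a) ^ N ≤ 1 + N * a + 4 ^ N * a ^ 2 := by
  obtain ⟨h1, h2⟩ := abs_le.1 h
  induction N with
  | zero => simp; positivity
  | succ N ih =>
    have hN : (N : ℝ) ≤ 4 ^ N := by
      exact_mod_cast (Nat.lt_pow_self (by norm_num : 1 < 4)).le
    have := mul_le_mul_of_nonneg_right ih (by linarith : 0 ≤ 1 + a)
    have h3 : (4 : ℝ) ^ N * a ^ 2 * a ≤ 4 ^ N * a ^ 2 * 1 := by gcongr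
    have h4 : (N : ℝ) * a ^ 2 ≤ 4 ^ N * a ^ 2 := by gcongr
    have h5 : (0 : ℝ) ≤ 4 ^ N * a ^ 2 := by positivity
    rw [pow_succ, pow_succ]
    push_cast
    nlinarith

lemma inv_pow_le_quadratic (N : ℕ) {s : ℝ} (h : |s| ≤ 1 / 2) :
    (1 - s)⁻¹ ^ N ≤ 1 + N * s + (2 * N + 4 * 4 ^ N) * s ^ 2 := by
  obtain ⟨h1, h2⟩ := abs_le.1 h
  have hp : 0 < 1 - s := by linarith
  have e : (1 - s)⁻¹ - 1 = s / (1 - s) := by field_simp; ring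
  have ha : |(1 - s)⁻¹ - 1| ≤ 2 * |s| := by
    rw [e, abs_div, abs_of_pos hp, div_le_iff₀ hp]
    nlinarith [abs_nonneg s]
  have ha' : (1 - s)⁻¹ - 1 ≤ s + 2 * s ^ 2 := by
    rw [e, div_le_iff₀ hp]
    nlinarith [mul_nonneg (sq_nonneg s) (by linarith : (0 : ℝ) ≤ 1 - 2 * s)]
  have hb := one_add_pow_le_quadratic N (a := (1 - s)⁻¹ - 1) (by linarith)
  rw [add_sub_cancel] at hb
  have h3 : ((1 - s)⁻¹ - 1) ^ 2 ≤ 4 * s ^ 2 := by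
    rw [← sq_abs, ← sq_abs s]
    nlinarith [abs_nonneg ((1 - s)⁻¹ - 1), abs_nonneg s]
  have h4 : (4 : ℝ) ^ N * ((1 - s)⁻¹ - 1) ^ 2 ≤ 4 ^ N * (4 * s ^ 2) := by gcongr
  have h5 : (N : ℝ) * ((1 - s)⁻¹ - 1) ≤ N * (s + 2 * s ^ 2) := by gcongr
  linarith

/-- A linear function that is `O(t²)` near `0` vanishes. -/
lemma eq_zero_of_forall_mul_le_sq {A C ε : ℝ} (hε : 0 < ε)
    (h : ∀ t, |t| < ε → A * t ≤ C * t ^ 2) : A = 0 := by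
  by_contra hA
  have hC : 0 < |C| + 1 := by positivity
  have hA' : 0 < |A| := abs_pos.2 hA
  set t := min (ε / 2) (|A| / (2 * (|C| + 1))) with ht
  have htpos : 0 < t := by positivity
  have h1 : t ≤ ε / 2 := min_le_left _ _
  have h2 : t ≤ |A| / (2 * (|C| + 1)) := min_le_right _ _
  rw [le_div_iff₀ (by positivity)] at h2
  have key : |A| * t ≤ C * t ^ 2 := by
    rcases abs_choice A with h' | h'
    · rw [h']
      exact h t (by rw [abs_of_pos htpos]; linarith)
    · rw [h']
      have := h (-t) (by rw [abs_neg, abs_of_pos htpos]; linarith)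
      linarith
  nlinarith [le_abs_self C, mul_pos htpos htpos, mul_pos hA' htpos]

lemma isCompact_polarBody {r : ℝ} (hr : 0 < r) (h : Metric.closedBall 0 r ⊆ K) :
    IsCompact (polarBody K 0) :=
  (isCompact_closedBall _ _).of_isClosed_subset (isClosed_polarBody _ _)
    (polarBody_subset_closedBall hr h)

lemma volume_real_polarBody_pos {r R : ℝ} (hr : 0 < r) (hR : 0 < R)
    (hrK : Metric.closedBall 0 r ⊆ K) (hKR : K ⊆ Metric.closedBall 0 R) :
    0 < volume.real (polarBody K 0) :=
  ENNReal.toReal_pos ((Metric.measure_closedBall_pos volume 0 (inv_pos.2 hR)).trans_le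
    (measure_mono (closedBall_subset_polarBody hR hKR))).ne'
    (isCompact_polarBody hr hrK).measure_lt_top.ne

/-- A lower bound, by a multiple of `‖z‖²`, for the second moment of a set containing a ball. -/
lemma le_setIntegral_inner_sq {R : ℝ} (hR : 0 < R) {A : Set (EuclideanSpace ℝ (Fin n))}
    (hA : IsCompact A) (h : Metric.closedBall 0 R⁻¹ ⊆ A) (z : EuclideanSpace ℝ (Fin n)) :
    (16 * R ^ 2)⁻¹ * volume.real (Metric.closedBall (0 : EuclideanSpace ℝ (Fin n)) (4 * R)⁻¹) *
      ‖z‖ ^ 2 ≤ ∫ y in A, ⟪z, y⟫ ^ 2 := by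
  by_cases hz : z = 0
  · simp [hz]
  have hz' : 0 < ‖z‖ := norm_pos_iff.2 hz
  -- on a ball around this point of `A`, the function `⟨z, ·⟩` is at least a multiple of `‖z‖`
  set p := (2 * R * ‖z‖)⁻¹ • z with hp
  have hnp : ‖p‖ = (2 * R)⁻¹ := by
    rw [hp, norm_smul, Real.norm_of_nonneg (by positivity)]; field_simp
  have hsub : Metric.closedBall p (4 * R)⁻¹ ⊆ A := by
    refine subset_trans ?_ h
    apply Metric.closedBall_subset_closedBall'
    rw [dist_zero_right, hnp]
    field_simp; norm_num
  have hint : IntegrableOn (fun y => ⟪z, y⟫ ^ 2) A :=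
    ContinuousOn.integrableOn_compact hA (by fun_prop)
  have hvol : volume.real (Metric.closedBall (0 : EuclideanSpace ℝ (Fin n)) (4 * R)⁻¹) =
      volume.real (Metric.closedBall p (4 * R)⁻¹) := by
    simp [Measure.real, Measure.addHaar_closedBall_center]
  calc _ = ∫ y in Metric.closedBall p (4 * R)⁻¹, (‖z‖ / (4 * R)) ^ 2 := by
        rw [setIntegral_const, hvol, smul_eq_mul]; field_simp; norm_num
    _ ≤ ∫ y in Metric.closedBall p (4 * R)⁻¹, ⟪z, y⟫ ^ 2 := by
        refine setIntegral_mono_on (by simp [measure_closedBall_lt_top]) (hint.mono_set hsub)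
          measurableSet_closedBall fun y hy => ?_
        have h1 : ⟪z, p⟫ = ‖z‖ / (2 * R) := by
          rw [hp, inner_smul_right, real_inner_self_eq_norm_sq]; field_simp
        have h2 : ⟪z, p - y⟫ ≤ ‖z‖ * (4 * R)⁻¹ :=
          (real_inner_le_norm _ _).trans (by
            gcongr; rw [← dist_eq_norm, dist_comm]; exact hy)
        rw [inner_sub_right, h1] at h2
        have h3 : ‖z‖ / (2 * R) - ‖z‖ * (4 * R)⁻¹ = ‖z‖ / (4 * R) := by field_simp; norm_num
        gcongr
        linarith
    _ ≤ _ := setIntegral_mono_set hint (Filter.Eventually.of_forall fun y => sq_nonneg _)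
        hsub.eventuallyLE

/-- No sign is assumed: where `f` or its integral is negative, `ENNReal.ofReal` truncates to `0`. -/
lemma ofReal_setIntegral_le_setLIntegral {A : Set (EuclideanSpace ℝ (Fin n))}
    (hA : MeasurableSet A) {f g : EuclideanSpace ℝ (Fin n) → ℝ}
    (hf : IntegrableOn f A) (h : ∀ y ∈ A, f y ≤ g y) :
    ENNReal.ofReal (∫ y in A, f y) ≤ ∫⁻ y in A, ENNReal.ofReal (g y) := by
  have h1 : ∫ y in A, f y ≤ ∫ y in A, max (f y) 0 :=
    integral_mono hf hf.pos_part fun y => le_max_left _ _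
  calc ENNReal.ofReal (∫ y in A, f y) ≤ ENNReal.ofReal (∫ y in A, max (f y) 0) :=
        ENNReal.ofReal_le_ofReal h1
    _ = ∫⁻ y in A, ENNReal.ofReal (max (f y) 0) :=
        ofReal_integral_eq_lintegral_ofReal hf.pos_part
          (Filter.Eventually.of_forall fun y => le_max_right _ _)
    _ ≤ _ := setLIntegral_mono' hA fun y hy => by
        rw [ENNReal.ofReal_le_ofReal_iff']
        have := h y hy
        rcases le_total (f y) 0 with h0 | h0
        · right; simp [h0]
        · left; rw [max_eq_left h0]; exact this

lemma setIntegral_quadratic {A : Set (EuclideanSpace ℝ (Fin n))} (hA : IsCompact A)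
    (z : EuclideanSpace ℝ (Fin n)) (a b : ℝ) :
    IntegrableOn (fun y => 1 + a * ⟪z, y⟫ + b * ⟪z, y⟫ ^ 2) A ∧
    ∫ y in A, (1 + a * ⟪z, y⟫ + b * ⟪z, y⟫ ^ 2) =
      volume.real A + a * (∫ y in A, ⟪z, y⟫) + b * ∫ y in A, ⟪z, y⟫ ^ 2 := by
  have hi1 : Integrable (fun y => a * ⟪z, y⟫) (volume.restrict A) :=
    ContinuousOn.integrableOn_compact hA (by fun_prop)
  have hi2 : Integrable (fun y => b * ⟪z, y⟫ ^ 2) (volume.restrict A) :=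
    ContinuousOn.integrableOn_compact hA (by fun_prop)
  have hi0 : Integrable (fun _ => (1 : ℝ)) (volume.restrict A) :=
    ContinuousOn.integrableOn_compact hA (by fun_prop)
  have hi3 : Integrable (fun y => 1 + a * ⟪z, y⟫) (volume.restrict A) := hi0.add hi1
  refine ⟨hi3.add hi2, ?_⟩
  rw [integral_add hi3 hi2, integral_add hi0 hi1, integral_const_mul, integral_const_mul,
    setIntegral_const, smul_eq_mul, mul_one]

/-- A lower bound for `|L^z|` by a quadratic polynomial in `z`, with a positive quadratic part that
depends only on an inner and an outer radius of `L`. -/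
lemma exists_quadratic_lower_bound (n : ℕ) {r R : ℝ} (hr : 0 < r) (hR : 0 < R) :
    ∃ c > 0, ∀ L : Set (EuclideanSpace ℝ (Fin n)), Metric.closedBall 0 r ⊆ L →
      L ⊆ Metric.closedBall 0 R → ∀ z ∈ interior L,
      ENNReal.ofReal (volume.real (polarBody L 0) + (n + 1) * (∫ y in polarBody L 0, ⟪z, y⟫) +
        c * ‖z‖ ^ 2) ≤ volume (polarBody L z) := by
  set κ := (16 * R ^ 2)⁻¹ *
    volume.real (Metric.closedBall (0 : EuclideanSpace ℝ (Fin n)) (4 * R)⁻¹) with hκ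
  have hκ0 : 0 < κ := by
    have : 0 < volume.real (Metric.closedBall (0 : EuclideanSpace ℝ (Fin n)) (4 * R)⁻¹) :=
      ENNReal.toReal_pos (Metric.measure_closedBall_pos _ _ (by positivity)).ne'
        measure_closedBall_lt_top.ne
    positivity
  refine ⟨(n + 1) / (1 + R * r⁻¹) * κ, by positivity, fun L hrL hLR z hz => ?_⟩
  have hcomp := isCompact_polarBody hr hrL
  have h0 : (0 : EuclideanSpace ℝ (Fin n)) ∈ interior L :=
    interior_mono hrL (by rw [mem_interior_iff_mem_nhds]; exact Metric.closedBall_mem_nhds _ hr)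
  rw [volume_polarBody_eq_lintegral h0 hz]
  have hle := ofReal_setIntegral_le_setLIntegral (isClosed_polarBody L 0).measurableSet
    (f := fun y => 1 + (n + 1) * ⟪z, y⟫ + (n + 1) / (1 + R * r⁻¹) * ⟪z, y⟫ ^ 2)
    (g := fun y => (1 - ⟪z, y⟫)⁻¹ ^ (n + 1))
    (setIntegral_quadratic hcomp z _ _).1 fun y hy => by
      have := one_add_mul_add_sq_le_inv_pow (n + 1) (R := R * r⁻¹) (s := ⟪z, y⟫)
        (by
          have h1 := mem_closedBall_zero_iff.1 (polarBody_subset_closedBall hr hrL hy)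
          have h2 := mem_closedBall_zero_iff.1 (hLR (interior_subset hz))
          have h3 : ‖z‖ * ‖y‖ ≤ R * r⁻¹ := by gcongr
          linarith [neg_le_of_abs_le (abs_real_inner_le_norm z y)])
        (inner_lt_one_of_mem_polarBody hz hy)
      push_cast at this
      exact this
  refine le_trans (ENNReal.ofReal_le_ofReal ?_) hle
  rw [(setIntegral_quadratic hcomp z _ _).2]
  have := le_setIntegral_inner_sq hR hcomp (closedBall_subset_polarBody hR hLR) z
  rw [mul_assoc]
  gcongr

/-- If the first moments of `L°` are small, then `|L°|` almost minimizes `z ↦ |L^z|`: the defect is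
quadratic in the first moments. -/
lemma exists_quadratic_defect (n : ℕ) {r R : ℝ} (hr : 0 < r) (hR : 0 < R) :
    ∃ C : ℝ, 0 ≤ C ∧ ∀ (L : Set (EuclideanSpace ℝ (Fin n))) (δ : ℝ), Metric.closedBall 0 r ⊆ L →
      L ⊆ Metric.closedBall 0 R →
      (∀ z, |∫ y in polarBody L 0, ⟪z, y⟫| ≤ δ * ‖z‖) → ∀ z ∈ interior L,
      ENNReal.ofReal (volume.real (polarBody L 0) - C * δ ^ 2) ≤ volume (polarBody L z) := by
  obtain ⟨c, hc, h⟩ := exists_quadratic_lower_bound n hr hR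
  refine ⟨(n + 1) ^ 2 / (4 * c), by positivity, fun L δ h1 h2 hδ z hz =>
    le_trans (ENNReal.ofReal_le_ofReal ?_) (h L h1 h2 z hz)⟩
  -- complete the square in `‖z‖`
  have h3 := neg_le_of_abs_le (hδ z)
  have h4 : -((n + 1) * (δ * ‖z‖)) ≤ (n + 1) * (∫ y in polarBody L 0, ⟪z, y⟫) := by
    rw [← mul_neg]; gcongr
  have h5 : 0 ≤ c * (‖z‖ - (n + 1) * δ / (2 * c)) ^ 2 := by positivity
  have h6 : c * (‖z‖ - (n + 1) * δ / (2 * c)) ^ 2 =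
      c * ‖z‖ ^ 2 - (n + 1) * (δ * ‖z‖) + (n + 1) ^ 2 / (4 * c) * δ ^ 2 := by
    field_simp; ring
  linarith

/-- The Santaló point condition at the origin: the centroid of `K°` is the origin. Indeed, `t ↦ |K^{tz}|`
has a minimum at `t = 0`, and its derivative there is `n + 1` times the first moment. -/
lemma setIntegral_inner_eq_zero {r R : ℝ} (hr : 0 < r) (hR : 0 < R)
    (hrK : Metric.closedBall 0 r ⊆ K) (hKR : K ⊆ Metric.closedBall 0 R) (hK : IsSantaloPoint K 0)
    (z : EuclideanSpace ℝ (Fin n)) :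
    ∫ y in polarBody K 0, ⟪z, y⟫ = 0 := by
  have hcomp := isCompact_polarBody hr hrK
  set D := 2 * ((n + 1 : ℕ) : ℝ) + 4 * 4 ^ (n + 1) with hD
  have hn : ((n : ℝ) + 1) ≠ 0 := by positivity
  suffices h : ((n : ℝ) + 1) * ∫ y in polarBody K 0, ⟪z, y⟫ = 0 by simpa [hn] using h
  rw [← neg_eq_zero]
  refine eq_zero_of_forall_mul_le_sq (C := D * ∫ y in polarBody K 0, ⟪z, y⟫ ^ 2)
    (ε := r / (2 * (‖z‖ + 1))) (by positivity) fun t ht => ?_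
  rw [lt_div_iff₀ (by positivity)] at ht
  have htz : ‖t • z‖ ≤ r / 2 := by
    rw [norm_smul, Real.norm_eq_abs]
    nlinarith [abs_nonneg t]
  have hint : t • z ∈ interior K := by
    refine interior_mono hrK (Metric.ball_subset_interior_closedBall ?_)
    rw [mem_ball_zero_iff]; linarith
  have h1 := hK.2 _ hint
  rw [volume_polarBody_eq_lintegral hK.1 hint] at h1
  have hb : ∀ y ∈ polarBody K 0, |⟪t • z, y⟫| ≤ 1 / 2 := fun y hy => by
    have h2 := mem_closedBall_zero_iff.1 (polarBody_subset_closedBall hr hrK hy)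
    calc |⟪t • z, y⟫| ≤ ‖t • z‖ * ‖y‖ := abs_real_inner_le_norm _ _
      _ ≤ r / 2 * r⁻¹ := by gcongr
      _ = 1 / 2 := by field_simp
  have hi : IntegrableOn (fun y => 1 + (n + 1) * t * ⟪z, y⟫ + D * t ^ 2 * ⟪z, y⟫ ^ 2)
    (polarBody K 0) := (setIntegral_quadratic hcomp z _ _).1
  have hq : ∀ y ∈ polarBody K 0, (1 - ⟪t • z, y⟫)⁻¹ ^ (n + 1) ≤
      1 + (n + 1) * t * ⟪z, y⟫ + D * t ^ 2 * ⟪z, y⟫ ^ 2 := fun y hy => by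
    have := inv_pow_le_quadratic (n + 1) (hb y hy)
    rw [← hD, inner_smul_left] at this
    push_cast at this
    rw [inner_smul_left]
    simp only [conj_trivial] at *
    linarith
  have h3 : volume (polarBody K 0) ≤ ENNReal.ofReal
      (∫ y in polarBody K 0, (1 + (n + 1) * t * ⟪z, y⟫ + D * t ^ 2 * ⟪z, y⟫ ^ 2)) := by
    refine h1.trans ?_
    rw [ofReal_integral_eq_lintegral_ofReal hi]
    · exact setLIntegral_mono' (isClosed_polarBody K 0).measurableSet fun y hy =>
        ENNReal.ofReal_le_ofReal (hq y hy)
    · refine (ae_restrict_iff' (isClosed_polarBody K 0).measurableSet).2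
        (Filter.Eventually.of_forall fun y hy => le_trans ?_ (hq y hy))
      have := (abs_le.1 (hb y hy)).2
      have : 0 < 1 - ⟪t • z, y⟫ := by linarith
      simp only [Pi.zero_apply]
      positivity
  rw [(setIntegral_quadratic hcomp z _ _).2] at h3
  have h4 := ENNReal.toReal_mono ENNReal.ofReal_ne_top h3
  rw [ENNReal.toReal_ofReal'] at h4
  have h5 : 0 < (volume (polarBody K 0)).toReal := volume_real_polarBody_pos hr hR hrK hKR
  rw [Measure.real] at h4
  -- the truncation in `ENNReal.ofReal` is not active, since `|K°| > 0`
  rcases le_max_iff.1 h4 with h6 | h6 <;> linarith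

/-- The first moments of two nested bodies differ by at most a multiple of the difference of the
volumes. -/
lemma abs_setIntegral_inner_sub_le {A B : Set (EuclideanSpace ℝ (Fin n))} {ρ : ℝ}
    (hA : IsCompact A) (hB : IsCompact B) (hAB : A ⊆ B) (hρ : B ⊆ Metric.closedBall 0 ρ)
    (z : EuclideanSpace ℝ (Fin n)) :
    |(∫ y in B, ⟪z, y⟫) - ∫ y in A, ⟪z, y⟫| ≤ ρ * (volume.real B - volume.real A) * ‖z‖ := by
  have hi1 : IntegrableOn (fun y => ⟪z, y⟫) B :=
    ContinuousOn.integrableOn_compact hB (by fun_prop)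
  rw [← setIntegral_sdiff hA.measurableSet hi1 hAB, ← measureReal_sdiff hAB hA.measurableSet
    hB.measure_lt_top.ne, ← Real.norm_eq_abs]
  refine (norm_setIntegral_le_of_norm_le_const (C := ρ * ‖z‖)
    ((measure_mono sdiff_subset).trans_lt hB.measure_lt_top) fun y hy => ?_).trans (le_of_eq ?_)
  · rw [Real.norm_eq_abs]
    refine (abs_real_inner_le_norm z y).trans ?_
    rw [mul_comm]
    have := mem_closedBall_zero_iff.1 (hρ hy.1)
    gcongr
  · ring

end

/-! ### Radial motion of a vertex -/

section

variable {n : ℕ} {K : Set (EuclideanSpace ℝ (Fin n))} {z : EuclideanSpace ℝ (Fin n)}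

lemma volume_setOf_inner_eq {x : EuclideanSpace ℝ (Fin n)} (hx : x ≠ 0) (c : ℝ) :
    volume {y | ⟪y, x⟫ = c} = 0 := by
  set A : AffineSubspace ℝ (EuclideanSpace ℝ (Fin n)) :=
    (AffineSubspace.mk' c (⊥ : Submodule ℝ ℝ)).comap (innerSL ℝ x).toLinearMap.toAffineMap
  have hA : {y | ⟪y, x⟫ = c} = (A : Set (EuclideanSpace ℝ (Fin n))) := by
    ext y
    simp [A, real_inner_comm, sub_eq_zero]
  rw [hA]
  refine Measure.addHaar_affineSubspace volume A fun htop => ?_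
  have h0 : (0 : EuclideanSpace ℝ (Fin n)) ∈ {y | ⟪y, x⟫ = c} := by rw [hA, htop]; trivial
  have h1 : x ∈ {y | ⟪y, x⟫ = c} := by rw [hA, htop]; trivial
  simp only [mem_ofPred_eq, inner_zero_left] at h0 h1
  rw [← h0] at h1
  exact hx (inner_self_eq_zero.1 h1)

/-- The polytope whose vertex `x` is replaced by `(1 + t) • x`, the other vertices being `S`. -/
def radialMove (S : Set (EuclideanSpace ℝ (Fin n))) (x : EuclideanSpace ℝ (Fin n)) (t : ℝ) :
    Set (EuclideanSpace ℝ (Fin n)) :=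
  convexHull ℝ (insert ((1 + t) • x) S)

variable {S : Set (EuclideanSpace ℝ (Fin n))} {x : EuclideanSpace ℝ (Fin n)}

lemma isCompact_radialMove (hS : S.Finite) (t : ℝ) : IsCompact (radialMove S x t) :=
  Set.Finite.isCompact_convexHull (𝕜 := ℝ) (hS.insert _)

lemma convex_radialMove (t : ℝ) : Convex ℝ (radialMove S x t) := convex_convexHull ℝ _

lemma mem_polarBody_radialMove {t : ℝ} {y : EuclideanSpace ℝ (Fin n)} :
    y ∈ polarBody (radialMove S x t) 0 ↔ (1 + t) * ⟪y, x⟫ ≤ 1 ∧ ∀ v ∈ S, ⟪y, v⟫ ≤ 1 := by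
  rw [radialMove, mem_polarBody_convexHull]
  simp [inner_smul_right]

/-- The origin stays in the polytope: from `0 = a x + b g` with `g ∈ conv S` one gets `0` as a convex
combination of `(1 + t) x` and `g`, with weights proportional to `a / (1 + t)` and `b`. -/
lemma zero_mem_radialMove (hS : S.Nonempty) (h0 : 0 ∈ radialMove S x 0) {t : ℝ} (ht : -1 < t) :
    0 ∈ radialMove S x t := by
  have ht' : 0 < 1 + t := by linarith
  rw [radialMove, add_zero, one_smul, convexHull_insert hS, mem_convexJoin] at h0
  obtain ⟨x', hx', g, hg, a, b, ha, hb, hab, h⟩ := h0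
  rw [mem_singleton_iff.1 hx'] at h
  have hσ : 0 < a / (1 + t) + b := by
    rcases eq_or_lt_of_le ha with h1 | h1
    · have : b = 1 := by linarith
      rw [this, ← h1]; simp
    · positivity
  obtain ⟨σ, hσe⟩ : ∃ σ, σ = a / (1 + t) + b := ⟨_, rfl⟩
  rw [← hσe] at hσ
  have hc := convex_radialMove (S := S) (x := x) t
    (subset_convexHull ℝ _ (mem_insert _ _) : (1 + t) • x ∈ radialMove S x t)
    (convexHull_mono (subset_insert _ _) hg : g ∈ radialMove S x t)
    (a := a / (1 + t) / σ) (b := b / σ)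
    (by positivity) (by positivity) (by rw [← add_div, ← hσe, div_self hσ.ne'])
  convert hc using 1
  have : (a / (1 + t) / σ) • (1 + t) • x + (b / σ) • g = σ⁻¹ • (a • x + b • g) := by
    rw [smul_add, smul_smul, smul_smul, smul_smul]
    congr 2
    · field_simp
    · field_simp
  rw [this, h, smul_zero]

lemma radialMove_mono (hS : S.Nonempty) (h0 : 0 ∈ radialMove S x 0) {s t : ℝ} (hs : -1 < s)
    (hst : s ≤ t) : radialMove S x s ⊆ radialMove S x t := by
  refine convexHull_min (insert_subset ?_ ?_) (convex_radialMove _)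
  · have ht' : 0 < 1 + t := by linarith
    have := (convex_radialMove (S := S) (x := x) t).smul_mem_of_zero_mem
      (zero_mem_radialMove hS h0 (by linarith)) (subset_convexHull ℝ _ (mem_insert _ _))
      (t := (1 + s) / (1 + t)) ⟨div_nonneg (by linarith) (by linarith),
        by rw [div_le_one ht']; linarith⟩
    rwa [smul_smul, div_mul_cancel₀ _ ht'.ne'] at this
  · exact (subset_insert _ _).trans (subset_convexHull ℝ _)

/-- Together with `radialMove_mono`, this sandwiches the moved polytopes between homothetic copies of
each other. -/
lemma smul_mem_radialMove (hS : S.Nonempty) (h0 : 0 ∈ radialMove S x 0) {s t : ℝ} (hs : -1 < s)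
    (hst : s ≤ t) {y : EuclideanSpace ℝ (Fin n)} (hy : y ∈ radialMove S x t) :
    ((1 + s) / (1 + t)) • y ∈ radialMove S x s := by
  have hs' : 0 < 1 + s := by linarith
  have ht' : 0 < 1 + t := by linarith
  have hconv : Convex ℝ ((fun y => ((1 + s) / (1 + t)) • y) ⁻¹' radialMove S x s) :=
    (convex_radialMove s).linear_preimage
      (LinearMap.lsmul ℝ (EuclideanSpace ℝ (Fin n)) ((1 + s) / (1 + t)))
  refine convexHull_min (insert_subset ?_ fun v hv => ?_) hconv hy
  · rw [mem_preimage, smul_smul, div_mul_cancel₀ _ ht'.ne']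
    exact subset_convexHull ℝ _ (mem_insert _ _)
  · exact (convex_radialMove s).smul_mem_of_zero_mem (zero_mem_radialMove hS h0 hs)
      (subset_convexHull ℝ _ (mem_insert_of_mem _ hv))
      ⟨by positivity, by rw [div_le_one ht']; linarith⟩

lemma volume_real_smul (c : ℝ) (A : Set (EuclideanSpace ℝ (Fin n))) (hc : 0 ≤ c) :
    volume.real (c • A) = c ^ n * volume.real A := by
  rw [Measure.real, Measure.addHaar_smul, finrank_euclideanSpace, Fintype.card_fin,
    ENNReal.toReal_mul, ENNReal.toReal_ofReal (abs_nonneg _), abs_of_nonneg (by positivity),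
    Measure.real]

lemma volume_real_radialMove_le (hfin : S.Finite) (hS : S.Nonempty) (h0 : 0 ∈ radialMove S x 0)
    {s t : ℝ} (hs : -1 < s) (hst : s ≤ t) :
    volume.real (radialMove S x s) ≤ volume.real (radialMove S x t) ∧
    ((1 + s) / (1 + t)) ^ n * volume.real (radialMove S x t) ≤ volume.real (radialMove S x s) := by
  refine ⟨measureReal_mono (radialMove_mono hS h0 hs hst)
    (isCompact_radialMove hfin t).measure_lt_top.ne, ?_⟩
  rw [← volume_real_smul _ _ (div_nonneg (by linarith) (by linarith))]
  refine measureReal_mono ?_ (isCompact_radialMove hfin s).measure_lt_top.ne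
  rintro _ ⟨y, hy, rfl⟩
  exact smul_mem_radialMove hS h0 hs hst hy

lemma volume_real_polarBody_radialMove_le (hS : S.Nonempty) (h0 : 0 ∈ radialMove S x 0)
    {s t : ℝ} (hs : -1 < s) (hst : s ≤ t) (hcs : IsCompact (polarBody (radialMove S x s) 0))
    (hct : IsCompact (polarBody (radialMove S x t) 0)) :
    volume.real (polarBody (radialMove S x t) 0) ≤ volume.real (polarBody (radialMove S x s) 0) ∧
    ((1 + s) / (1 + t)) ^ n * volume.real (polarBody (radialMove S x s) 0) ≤
      volume.real (polarBody (radialMove S x t) 0) := by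
  refine ⟨measureReal_mono (polarBody_anti (radialMove_mono hS h0 hs hst))
    hcs.measure_lt_top.ne, ?_⟩
  rw [← volume_real_smul _ _ (div_nonneg (by linarith) (by linarith))]
  refine measureReal_mono ?_ hct.measure_lt_top.ne
  rintro _ ⟨y, hy, rfl⟩
  refine mem_polarBody_zero.2 fun v hv => ?_
  have := mem_polarBody_zero.1 hy _ (smul_mem_radialMove hS h0 hs hst hv)
  simpa [inner_smul_left, inner_smul_right] using this

lemma closedBall_subset_radialMove (hS : S.Nonempty) {r : ℝ} (hr : 0 < r)
    (h : Metric.closedBall 0 r ⊆ radialMove S x 0) {t : ℝ} (ht : |t| ≤ 1 / 2) :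
    Metric.closedBall 0 (r / 2) ⊆ radialMove S x t := by
  have h0 : 0 ∈ radialMove S x 0 := h (Metric.mem_closedBall_self hr.le)
  intro y hy
  refine radialMove_mono hS h0 (s := -(1 / 2)) (by norm_num) (by linarith [(abs_le.1 ht).1]) ?_
  have := smul_mem_radialMove hS h0 (s := -(1 / 2)) (t := 0) (by norm_num) (by norm_num)
    (y := (2 : ℝ) • y) (h (by
      rw [mem_closedBall_zero_iff] at *
      rw [norm_smul, Real.norm_of_nonneg (by norm_num)]; linarith))
  rw [smul_smul] at this
  norm_num at this
  exact this

lemma radialMove_subset_closedBall {R : ℝ} (h : radialMove S x 0 ⊆ Metric.closedBall 0 R) {t : ℝ}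
    (ht : |t| ≤ 1 / 2) : radialMove S x t ⊆ Metric.closedBall 0 (2 * R) := by
  obtain ⟨h1, h2⟩ := abs_le.1 ht
  have hx : ‖x‖ ≤ R := mem_closedBall_zero_iff.1 (h (subset_convexHull ℝ _ (by simp)))
  have hR : 0 ≤ R := (norm_nonneg x).trans hx
  refine convexHull_min (insert_subset ?_ fun v hv => ?_) (convex_closedBall _ _)
  · rw [mem_closedBall_zero_iff, norm_smul, Real.norm_of_nonneg (by linarith)]
    exact mul_le_mul (by linarith) hx (norm_nonneg _) (by norm_num)
  · have := mem_closedBall_zero_iff.1 (h (subset_convexHull ℝ _ (mem_insert_of_mem _ hv)))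
    rw [mem_closedBall_zero_iff]; linarith

/-- The volume of the polar body is Lipschitz at `t = 0`. -/
lemma abs_volume_real_polarBody_radialMove_sub_le (hS : S.Nonempty) {r : ℝ} (hr : 0 < r)
    (h : Metric.closedBall 0 r ⊆ radialMove S x 0) {t : ℝ} (ht : |t| ≤ 1 / 2) :
    |volume.real (polarBody (radialMove S x t) 0) - volume.real (polarBody (radialMove S x 0) 0)|
      ≤ (3 * n + 4 * 4 ^ n) * volume.real (polarBody (radialMove S x 0) 0) * |t| := by
  have h0 : 0 ∈ radialMove S x 0 := h (Metric.mem_closedBall_self hr.le)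
  have hct := isCompact_polarBody (half_pos hr) (closedBall_subset_radialMove hS hr h ht)
  have hc0 := isCompact_polarBody hr h
  obtain ⟨h1, h2⟩ := abs_le.1 ht
  set p := volume.real (polarBody (radialMove S x 0) 0) with hp
  have hp0 : 0 ≤ p := measureReal_nonneg
  have hn : (0 : ℝ) ≤ n := n.cast_nonneg
  have h4 : (0 : ℝ) ≤ 4 * 4 ^ n := by positivity
  rcases le_total 0 t with h5 | h5
  · obtain ⟨h6, h7⟩ := volume_real_polarBody_radialMove_le hS h0 (by norm_num) h5 hc0 hct
    rw [← hp] at h6 h7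
    rw [abs_of_nonneg h5, abs_sub_comm, abs_of_nonneg (by linarith)]
    have h8 : 1 - n * t ≤ ((1 + 0) / (1 + t)) ^ n := by
      have h9 : 1 - t ≤ (1 + 0) / (1 + t) := by rw [le_div_iff₀ (by linarith)]; nlinarith
      have h10 := one_add_mul_le_pow (a := -t) (by linarith) n
      calc _ ≤ (1 + -t) ^ n := by linarith
        _ ≤ _ := by gcongr ?_ ^ n <;> linarith
    have h11 := mul_le_mul_of_nonneg_right h8 hp0
    have : 0 ≤ (2 * n + 4 * 4 ^ n) * p * t := by positivity
    nlinarith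
  · obtain ⟨h6, h7⟩ := volume_real_polarBody_radialMove_le hS h0 (by linarith) h5 hct hc0
    rw [← hp] at h6 h7
    rw [abs_of_nonpos h5, abs_of_nonneg (by linarith)]
    have h8 := inv_pow_le_quadratic n (s := -t) (by rwa [abs_neg])
    have h9 : 0 < 1 + t := by linarith
    have h10 : volume.real (polarBody (radialMove S x t) 0) ≤ (1 - -t)⁻¹ ^ n * p := by
      rw [add_zero, div_one] at h7
      rw [inv_pow, sub_neg_eq_add, le_inv_mul_iff₀ (by positivity)]
      exact h7
    have h11 := mul_le_mul_of_nonneg_right h8 hp0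
    have h12 : (2 * n + 4 * 4 ^ n) * (-t) ^ 2 ≤ (2 * n + 4 * 4 ^ n) * (-t) := by
      gcongr; nlinarith
    have h13 := mul_le_mul_of_nonneg_right h12 hp0
    nlinarith

/-- The volume of the polytope is Lipschitz at `t = 0`. -/
lemma abs_volume_real_radialMove_sub_le (hfin : S.Finite) (hS : S.Nonempty)
    (h0 : 0 ∈ radialMove S x 0) {t : ℝ} (ht : |t| ≤ 1 / 2) :
    |volume.real (radialMove S x t) - volume.real (radialMove S x 0)|
      ≤ (n + 4 ^ n) * volume.real (radialMove S x 0) * |t| := by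
  obtain ⟨h1, h2⟩ := abs_le.1 ht
  set p := volume.real (radialMove S x 0) with hp
  have hp0 : 0 ≤ p := measureReal_nonneg
  have hn : (0 : ℝ) ≤ n := n.cast_nonneg
  rcases le_total 0 t with h5 | h5
  · obtain ⟨h6, h7⟩ := volume_real_radialMove_le hfin hS h0 (by norm_num) h5
    rw [← hp] at h6 h7
    rw [abs_of_nonneg h5, abs_of_nonneg (by linarith)]
    have h8 := one_add_pow_le_quadratic n (a := t) (by rw [abs_of_nonneg h5]; linarith)
    have h10 : volume.real (radialMove S x t) ≤ (1 + t) ^ n * p := by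
      rw [add_zero, div_pow, one_pow, div_mul_eq_mul_div, one_mul, div_le_iff₀ (by positivity)] at h7
      linarith
    have h11 := mul_le_mul_of_nonneg_right h8 hp0
    have h12 : (4 : ℝ) ^ n * t ^ 2 ≤ 4 ^ n * t := by gcongr; nlinarith
    have h13 := mul_le_mul_of_nonneg_right h12 hp0
    nlinarith
  · obtain ⟨h6, h7⟩ := volume_real_radialMove_le hfin hS h0 (by linarith) h5
    rw [← hp] at h6 h7
    rw [abs_of_nonpos h5, abs_sub_comm, abs_of_nonneg (by linarith)]
    have h8 := one_add_mul_le_pow (a := t) (by linarith) n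
    rw [add_zero, div_one] at h7
    have h11 := mul_le_mul_of_nonneg_right h8 hp0
    have : 0 ≤ 4 ^ n * p * (-t) := mul_nonneg (by positivity) (by linarith)
    nlinarith

end

/-! ### Expansion of the volume of the polar body -/

section

variable {n : ℕ} {K S : Set (EuclideanSpace ℝ (Fin n))} {x q z : EuclideanSpace ℝ (Fin n)}

/-- Two pyramids over the same base in the hyperplane `⟨·, x⟩ = 1`, with apexes `0` and `q`: their
volumes are proportional to the distances of the apexes from the hyperplane. -/
lemma volume_real_convexHull_insert {F : Set (EuclideanSpace ℝ (Fin n))}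
    (hF : ∀ y ∈ F, ⟪y, x⟫ = 1) (q : EuclideanSpace ℝ (Fin n)) :
    volume.real (convexHull ℝ (insert q F)) =
      |1 - ⟪q, x⟫| * volume.real (convexHull ℝ (insert 0 F)) := by
  set L : EuclideanSpace ℝ (Fin n) →ₗ[ℝ] EuclideanSpace ℝ (Fin n) :=
    LinearMap.transvection (-((innerSL ℝ x : EuclideanSpace ℝ (Fin n) →L[ℝ] ℝ) :
        EuclideanSpace ℝ (Fin n) →ₗ[ℝ] ℝ)) q with hL
  have hLy : ∀ y, L y = y - ⟪y, x⟫ • q := fun y => by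
    simp [hL, LinearMap.transvection, real_inner_comm, sub_eq_add_neg]
  have hdet : LinearMap.det L = 1 - ⟪q, x⟫ := by
    rw [hL, LinearMap.transvection.det]
    simp [real_inner_comm, sub_eq_add_neg]
  have himg : convexHull ℝ (insert q F) = q +ᵥ (L '' convexHull ℝ (insert 0 F)) := by
    rw [LinearMap.image_convexHull, ← convexHull_vadd]
    congr 1
    rw [image_insert_eq, map_zero, ← image_vadd, image_insert_eq, vadd_eq_add, add_zero]
    congr 1
    rw [image_image]
    conv_lhs => rw [← image_id F]
    refine image_congr fun y hy => ?_
    rw [hLy, hF y hy]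
    simp
  rw [himg, Measure.real, measure_vadd, Measure.addHaar_image_linearMap, hdet,
    ENNReal.toReal_mul, ENNReal.toReal_ofReal (abs_nonneg _), Measure.real]

lemma volume_real_image_homothety (q : EuclideanSpace ℝ (Fin n)) {c : ℝ} (hc : 0 ≤ c)
    (A : Set (EuclideanSpace ℝ (Fin n))) :
    volume.real (AffineMap.homothety q c '' A) = c ^ n * volume.real A := by
  rw [Measure.real, Measure.addHaar_image_homothety, finrank_euclideanSpace, Fintype.card_fin,
    ENNReal.toReal_mul, ENNReal.toReal_ofReal (abs_nonneg _), abs_of_nonneg (by positivity),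
    Measure.real]

lemma mem_convexHull_insert_of_convex {F : Set (EuclideanSpace ℝ (Fin n))} (hF : Convex ℝ F)
    (hne : F.Nonempty) {y : EuclideanSpace ℝ (Fin n)} :
    y ∈ convexHull ℝ (insert q F) ↔ ∃ f ∈ F, ∃ θ : ℝ, 0 ≤ θ ∧ θ ≤ 1 ∧ y = q + θ • (f - q) := by
  rw [convexHull_insert hne, hF.convexHull_eq, mem_convexJoin]
  simp only [mem_singleton_iff, exists_eq_left, segment_eq_image']
  constructor
  · rintro ⟨f, hf, θ, ⟨h1, h2⟩, rfl⟩
    exact ⟨f, hf, θ, h1, h2, rfl⟩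
  · rintro ⟨f, hf, θ, h1, h2, rfl⟩
    exact ⟨f, hf, θ, ⟨h1, h2⟩, rfl⟩

lemma homothety_image_mono {C : Set (EuclideanSpace ℝ (Fin n))} (hC : Convex ℝ C) (hq : q ∈ C)
    {a b : ℝ} (ha : 0 ≤ a) (hab : a ≤ b) :
    AffineMap.homothety q a '' C ⊆ AffineMap.homothety q b '' C := by
  rintro _ ⟨y, hy, rfl⟩
  rcases eq_or_lt_of_le (ha.trans hab) with hb | hb
  · have : a = b := by linarith
    rw [this]; exact mem_image_of_mem _ hy
  refine ⟨q + (a / b) • (y - q), hC.add_smul_sub_mem hq hy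
    ⟨by positivity, by rw [div_le_one hb]; exact hab⟩, ?_⟩
  simp only [AffineMap.homothety_apply, vsub_eq_sub, vadd_eq_add, add_sub_cancel_left, smul_smul]
  rw [mul_div_cancel₀ _ hb.ne']

/-- Moving the facet hyperplane `⟨·, x⟩ = 1` of the polar body to the level `τ`: the pyramid over
the facet with apex `q` beyond the hyperplane controls the change of the volume. -/
lemma volume_real_polar_level_ge {A : Set (EuclideanSpace ℝ (Fin n))} (hA : Convex ℝ A)
    (hx : x ≠ 0) {h τ : ℝ} (hh : 0 < h) (hqA : q ∈ A) (hq : ⟪q, x⟫ = 1 + h)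
    (hτ : |1 - τ| ≤ h)
    (hb1 : Bornology.IsBounded (A ∩ {y | ⟪y, x⟫ ≤ 1}))
    (hbτ : Bornology.IsBounded (A ∩ {y | ⟪y, x⟫ ≤ τ}))
    (hne : (A ∩ {y | ⟪y, x⟫ = 1}).Nonempty) :
    volume.real (A ∩ {y | ⟪y, x⟫ ≤ 1}) -
      h * volume.real (convexHull ℝ (insert 0 (A ∩ {y | ⟪y, x⟫ = 1}))) *
        ((1 + (1 - τ) / h) ^ n - 1) ≤ volume.real (A ∩ {y | ⟪y, x⟫ ≤ τ}) := by
  set F := A ∩ {y | ⟪y, x⟫ = 1} with hF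
  set C := convexHull ℝ (insert q F) with hC
  have hlin : IsLinearMap ℝ fun y : EuclideanSpace ℝ (Fin n) => ⟪y, x⟫ :=
    ⟨fun a b => inner_add_left _ _ _, fun c a => by simp [inner_smul_left]⟩
  have hFconv : Convex ℝ F := hA.inter (convex_hyperplane hlin 1)
  have hcx : ∀ c, Convex ℝ (A ∩ {y | ⟪y, x⟫ ≤ c}) := fun c => hA.inter (convex_halfSpace_le hlin c)
  have hvol : volume.real C = h * volume.real (convexHull ℝ (insert 0 F)) := by
    rw [hC, volume_real_convexHull_insert (fun y hy => hy.2), hq]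
    rw [show 1 - (1 + h) = -h by ring, abs_neg, abs_of_pos hh]
  rw [← hvol]
  have hFb : Bornology.IsBounded F := hb1.subset fun y hy => ⟨hy.1, le_of_eq hy.2⟩
  have hCb : Bornology.IsBounded C := isBounded_convexHull.2 (hFb.insert q)
  have hCconv : Convex ℝ C := convex_convexHull _ _
  have hqC : q ∈ C := subset_convexHull ℝ _ (mem_insert _ _)
  have hCA : C ⊆ A := convexHull_min (insert_subset hqA fun y hy => hy.1) hA
  set σ := (1 - τ) / h with hσ
  have hσ1 : |σ| ≤ 1 := by rw [hσ, abs_div, abs_of_pos hh, div_le_one hh]; exact hτ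
  obtain ⟨hσ2, hσ3⟩ := abs_le.1 hσ1
  have hτσ : τ = 1 - σ * h := by rw [hσ]; field_simp; ring
  set H := AffineMap.homothety q (1 + σ) '' C with hH
  have hHconv : Convex ℝ H := hCconv.affine_image _
  have hHvol : volume.real H = (1 + σ) ^ n * volume.real C :=
    volume_real_image_homothety _ (by linarith) _
  have hCfin : volume C ≠ ⊤ := hCb.measure_lt_top.ne
  have hHfin : volume H ≠ ⊤ := by
    rw [hH, Measure.addHaar_image_homothety]
    exact ENNReal.mul_ne_top ENNReal.ofReal_ne_top hCfin
  have hlev : ∀ y ∈ C, 1 ≤ ⟪y, x⟫ := by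
    have : Convex ℝ {y : EuclideanSpace ℝ (Fin n) | 1 ≤ ⟪y, x⟫} := convex_halfSpace_ge hlin 1
    refine fun y hy => convexHull_min (insert_subset ?_ fun y hy => ?_) this hy
    · simp only [mem_ofPred_eq]; linarith
    · exact ge_of_eq hy.2
  have hplane : volume.real {y | ⟪y, x⟫ = 1} = 0 := by
    rw [Measure.real, volume_setOf_inner_eq hx, ENNReal.toReal_zero]
  have hplane' : volume {y | ⟪y, x⟫ = 1} ≠ ⊤ := by rw [volume_setOf_inner_eq hx]; simp
  -- the homothety with centre `q` and ratio `1 + σ` carries the level `1` to the level `τ`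
  rcases le_total 0 σ with hs | hs
  · have hsub : A ∩ {y | ⟪y, x⟫ ≤ 1} ⊆ (A ∩ {y | ⟪y, x⟫ ≤ τ}) ∪ (H \ C) ∪ {y | ⟪y, x⟫ = 1} := by
      rintro y ⟨hyA, hy1⟩
      by_cases h1 : ⟪y, x⟫ = 1
      · exact Or.inr h1
      refine Or.inl ?_
      by_cases h2 : ⟪y, x⟫ ≤ τ
      · exact Or.inl ⟨hyA, h2⟩
      refine Or.inr ⟨?_, fun hyC => h1 (le_antisymm hy1 (hlev y hyC))⟩
      have hd : 0 < 1 + h - ⟪y, x⟫ := by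
        have : ⟪y, x⟫ ≤ 1 := hy1
        linarith
      set θ := h / (1 + h - ⟪y, x⟫) with hθ
      have hθ0 : 0 < θ := by positivity
      have hθ1 : θ ≤ 1 := by
        rw [hθ, div_le_one hd]
        have : ⟪y, x⟫ ≤ 1 := hy1
        linarith
      -- the point where the segment from `q` to `y` crosses the hyperplane
      have hf : q + θ • (y - q) ∈ F := by
        refine ⟨hA.add_smul_sub_mem hqA hyA ⟨hθ0.le, hθ1⟩, ?_⟩
        simp only [mem_ofPred_eq, inner_add_left, inner_smul_left, inner_sub_left, hq, conj_trivial]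
        rw [hθ]; field_simp; ring
      refine homothety_image_mono hCconv hqC (a := θ⁻¹) (by positivity) ?_
        ⟨_, subset_convexHull ℝ _ (mem_insert_of_mem _ hf), ?_⟩
      · rw [hθ, inv_div, div_le_iff₀ hh]
        push Not at h2
        linarith
      · simp only [AffineMap.homothety_apply, vsub_eq_sub, vadd_eq_add, add_sub_cancel_left,
          smul_smul]
        rw [inv_mul_cancel₀ hθ0.ne', one_smul, sub_add_cancel]
    have hCH : C ⊆ H := by
      have := homothety_image_mono hCconv hqC (a := 1) (b := 1 + σ) zero_le_one (by linarith)
      rwa [AffineMap.homothety_one, AffineMap.coe_id, image_id] at this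
    have h3 := measureReal_mono (μ := volume) hsub (measure_union_ne_top
      (measure_union_ne_top hbτ.measure_lt_top.ne
      (measure_ne_top_of_subset sdiff_subset hHfin)) hplane')
    have h4 := measureReal_union_le (μ := volume) (A ∩ {y | ⟪y, x⟫ ≤ τ} ∪ (H \ C)) {y | ⟪y, x⟫ = 1}
    have h5 := measureReal_union_le (μ := volume) (A ∩ {y | ⟪y, x⟫ ≤ τ}) (H \ C)
    have h6 : volume.real (H \ C) = volume.real H - volume.real C := by
      rw [Measure.real, measure_sdiff hCH (hCconv.nullMeasurableSet _) hCfin,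
        ENNReal.toReal_sub_of_le (measure_mono hCH) hHfin]
      rfl
    rw [hplane] at h4
    rw [h6, hHvol] at h5
    linarith
  · have hHC : H ⊆ C := by
      have := homothety_image_mono hCconv hqC (a := 1 + σ) (b := 1) (by linarith) (by linarith)
      rwa [AffineMap.homothety_one, AffineMap.coe_id, image_id] at this
    have hsub : (A ∩ {y | ⟪y, x⟫ ≤ 1}) ∪ (C \ H) ⊆ A ∩ {y | ⟪y, x⟫ ≤ τ} := by
      refine union_subset (fun y hy => ⟨hy.1, ?_⟩) fun y hy => ⟨hCA hy.1, ?_⟩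
      · have : ⟪y, x⟫ ≤ 1 := hy.2
        simp only [mem_ofPred_eq]
        nlinarith
      · simp only [mem_ofPred_eq]
        by_contra! hlt
        obtain ⟨f, hf, θ, h1, h2, rfl⟩ := (mem_convexHull_insert_of_convex hFconv hne).1 hy.1
        refine hy.2 ?_
        have hfx : ⟪f, x⟫ = 1 := hf.2
        simp only [inner_add_left, inner_smul_left, inner_sub_left, hq, hfx, conj_trivial] at hlt
        refine homothety_image_mono hCconv hqC (a := θ) h1 ?_
          ⟨f, subset_convexHull ℝ _ (mem_insert_of_mem _ hf), ?_⟩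
        · by_contra! h3
          nlinarith
        · simp [AffineMap.homothety_apply, add_comm]
    have hdisj : AEDisjoint volume (A ∩ {y | ⟪y, x⟫ ≤ 1}) (C \ H) := by
      refine measure_mono_null ?_ (volume_setOf_inner_eq hx 1)
      exact fun y hy => le_antisymm hy.1.2 (hlev y hy.2.1)
    have h3 := measureReal_mono (μ := volume) hsub hbτ.measure_lt_top.ne
    have h4 : volume.real ((A ∩ {y | ⟪y, x⟫ ≤ 1}) ∪ (C \ H)) =
        volume.real (A ∩ {y | ⟪y, x⟫ ≤ 1}) + (volume.real C - volume.real H) := by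
      rw [Measure.real, measure_union₀ ((hCconv.nullMeasurableSet _).diff
        (hHconv.nullMeasurableSet _)) hdisj, ENNReal.toReal_add hb1.measure_lt_top.ne
        (measure_ne_top_of_subset sdiff_subset hCfin),
        measure_sdiff hHC (hHconv.nullMeasurableSet _) hHfin,
        ENNReal.toReal_sub_of_le (measure_mono hHC) hCfin]
      rfl
    rw [h4, hHvol] at h3
    linarith

/-- The lower expansion of the volume of the polar body under a radial motion of the vertex `x`, valid
for both signs of `t`. The polar body of the moved polytope is cut out of the unbounded polyhedron
`{y | ⟨y, v⟩ ≤ 1 for v ∈ S}` by `⟨y, x⟩ ≤ (1 + t)⁻¹`; the point `q` of the polyhedron lies beyond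
these hyperplanes. -/
lemma exists_volume_real_polarBody_radialMove_ge (hS : S.Nonempty) {r : ℝ} (hr : 0 < r)
    (hball : Metric.closedBall 0 r ⊆ radialMove S x 0) (hx : x ≠ 0)
    (hqS : ∀ v ∈ S, ⟪q, v⟫ ≤ 1) (hqx : 1 < ⟪q, x⟫) :
    ∃ C ε : ℝ, 0 < ε ∧ 0 ≤ C ∧ ∀ t, |t| ≤ ε →
      volume.real (polarBody (radialMove S x 0) 0) -
        n * (coneVolume (dualFacet (radialMove S x 0) x)).toReal * t - C * t ^ 2 ≤
      volume.real (polarBody (radialMove S x t) 0) := by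
  set h := ⟪q, x⟫ - 1 with hh
  have hh0 : 0 < h := by linarith
  set A := {y : EuclideanSpace ℝ (Fin n) | ∀ v ∈ S, ⟪y, v⟫ ≤ 1} with hA
  have hAconv : Convex ℝ A := by
    intro a ha b hb s t hs ht hst v hv
    simp only [inner_add_left, inner_smul_left, conj_trivial]
    nlinarith [mul_le_mul_of_nonneg_left (ha v hv) hs, mul_le_mul_of_nonneg_left (hb v hv) ht]
  have hpol : ∀ t : ℝ, -1 < t →
      polarBody (radialMove S x t) 0 = A ∩ {y | ⟪y, x⟫ ≤ (1 + t)⁻¹} := fun t ht => by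
    ext y
    rw [mem_polarBody_radialMove, and_comm, ← one_div,
      show (y ∈ A ∩ {y | ⟪y, x⟫ ≤ 1 / (1 + t)} ↔ y ∈ A ∧ ⟪y, x⟫ ≤ 1 / (1 + t)) from Iff.rfl,
      le_div_iff₀ (by linarith), mul_comm]
    rfl
  have hpol0 : polarBody (radialMove S x 0) 0 = A ∩ {y | ⟪y, x⟫ ≤ 1} := by
    simpa using hpol 0 (by norm_num)
  have hdual : dualFacet (radialMove S x 0) x = A ∩ {y | ⟪y, x⟫ = 1} := by
    ext y
    have : y ∈ dualFacet (radialMove S x 0) x ↔ y ∈ polarBody (radialMove S x 0) 0 ∧ ⟪y, x⟫ = 1 :=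
      Iff.rfl
    rw [this, hpol0]
    exact ⟨fun h => ⟨h.1.1, h.2⟩, fun h => ⟨⟨h.1, le_of_eq h.2⟩, h.2⟩⟩
  have hne : (A ∩ {y | ⟪y, x⟫ = 1}).Nonempty := by
    refine ⟨(⟪q, x⟫)⁻¹ • q, fun v hv => ?_, ?_⟩
    · rw [inner_smul_left, conj_trivial]
      have h1 := hqS v hv
      rw [inv_mul_le_iff₀ (by linarith)]
      linarith
    · simp only [mem_ofPred_eq, inner_smul_left, conj_trivial]
      exact inv_mul_cancel₀ (by linarith)
  set D := (coneVolume (dualFacet (radialMove S x 0) x)).toReal with hD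
  have hD' : D = volume.real (convexHull ℝ (insert 0 (A ∩ {y | ⟪y, x⟫ = 1}))) := by
    rw [hD, hdual]; rfl
  have hD0 : 0 ≤ D := ENNReal.toReal_nonneg
  refine ⟨4 ^ n * 4 * D / h, min (1 / 2) (h / 2), by positivity, by positivity, fun t ht => ?_⟩
  have ht1 : |t| ≤ 1 / 2 := ht.trans (min_le_left _ _)
  have ht2 : |t| ≤ h / 2 := ht.trans (min_le_right _ _)
  obtain ⟨ht3, ht4⟩ := abs_le.1 ht1
  have hp : 0 < 1 + t := by linarith
  have e : 1 - (1 + t)⁻¹ = t / (1 + t) := by field_simp; ring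
  have hτ : |1 - (1 + t)⁻¹| ≤ 2 * |t| := by
    rw [e, abs_div, abs_of_pos hp, div_le_iff₀ hp]
    nlinarith [abs_nonneg t]
  have hb1 := (isCompact_polarBody hr hball).isBounded
  have hbt := (isCompact_polarBody (half_pos hr)
    (closedBall_subset_radialMove hS hr hball ht1)).isBounded
  rw [hpol0] at hb1
  rw [hpol t (by linarith)] at hbt
  have key := volume_real_polar_level_ge hAconv hx hh0 (q := q) hqS (by linarith)
    (τ := (1 + t)⁻¹) (by linarith) hb1 hbt hne
  rw [← hpol0, ← hpol t (by linarith), ← hD'] at key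
  refine le_trans ?_ key
  set σ := (1 - (1 + t)⁻¹) / h with hσ
  have hσabs : |σ| ≤ 2 * |t| / h := by
    rw [hσ, abs_div, abs_of_pos hh0]
    gcongr
  have hσ1 : |σ| ≤ 1 := hσabs.trans (by rw [div_le_one hh0]; linarith)
  have h1 := one_add_pow_le_quadratic n hσ1
  have h2 : σ ^ 2 ≤ 4 * t ^ 2 / h ^ 2 := by
    rw [← sq_abs σ, ← sq_abs t]
    calc |σ| ^ 2 ≤ (2 * |t| / h) ^ 2 := by gcongr
      _ = _ := by ring_nf
  have h3 : σ * h ≤ t := by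
    rw [hσ, div_mul_cancel₀ _ hh0.ne', e, div_le_iff₀ hp]
    nlinarith [sq_nonneg t]
  have h4 : (1 + σ) ^ n - 1 ≤ n * σ + 4 ^ n * (4 * t ^ 2 / h ^ 2) := by
    have : (4 : ℝ) ^ n * σ ^ 2 ≤ 4 ^ n * (4 * t ^ 2 / h ^ 2) := by gcongr
    linarith
  have h5 : h * D * ((1 + σ) ^ n - 1) ≤ h * D * (n * σ + 4 ^ n * (4 * t ^ 2 / h ^ 2)) := by gcongr
  have h6 : h * D * (n * σ + 4 ^ n * (4 * t ^ 2 / h ^ 2)) =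
      n * D * (σ * h) + 4 ^ n * 4 * D / h * t ^ 2 := by field_simp
  have h7 : n * D * (σ * h) ≤ n * D * t := by gcongr
  linarith

/-- The envelope estimate: if the Santaló point of the polytope is the origin, then all polar bodies
of the moved polytope, with any centre, satisfy the expansion of the polar body centred at `0`. -/
lemma exists_volume_polarBody_radialMove_ge (hS : S.Nonempty) (hfin : S.Finite)
    (hsan : IsSantaloPoint (radialMove S x 0) 0) (hx : x ≠ 0)
    (hqS : ∀ v ∈ S, ⟪q, v⟫ ≤ 1) (hqx : 1 < ⟪q, x⟫) :
    ∃ C ε : ℝ, 0 < ε ∧ ε ≤ 1 / 2 ∧ 0 ≤ C ∧ ∀ t, |t| ≤ ε → ∀ z ∈ interior (radialMove S x t),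
      ENNReal.ofReal (volume.real (polarBody (radialMove S x 0) 0) -
        n * (coneVolume (dualFacet (radialMove S x 0) x)).toReal * t - C * t ^ 2) ≤
      volume (polarBody (radialMove S x t) z) := by
  obtain ⟨r, hr, hball⟩ := Metric.nhds_basis_closedBall.mem_iff.1
    (mem_interior_iff_mem_nhds.1 hsan.1)
  obtain ⟨R, hR, hbR⟩ := (isCompact_radialMove hfin (x := x) 0).isBounded.subset_closedBall_lt 0 0
  obtain ⟨C₁, ε, hε, hC₁, h1⟩ := exists_volume_real_polarBody_radialMove_ge hS hr hball hx hqS hqx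
  obtain ⟨C₂, hC₂, h2⟩ := exists_quadratic_defect n (half_pos hr) (by linarith : 0 < 2 * R)
  set M := (r / 2)⁻¹ * ((3 * n + 4 * 4 ^ n) * volume.real (polarBody (radialMove S x 0) 0)) with hM
  refine ⟨C₁ + C₂ * M ^ 2, min ε (1 / 2), by positivity, min_le_right _ _, by positivity,
    fun t ht z hz => ?_⟩
  have ht1 : |t| ≤ ε := ht.trans (min_le_left _ _)
  have ht2 : |t| ≤ 1 / 2 := ht.trans (min_le_right _ _)
  have hballt := closedBall_subset_radialMove hS hr hball ht2
  have hbRt := radialMove_subset_closedBall hbR ht2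
  have hct := isCompact_polarBody (half_pos hr) hballt
  have hc0 := isCompact_polarBody hr hball
  have h0 : 0 ∈ radialMove S x 0 := interior_subset hsan.1
  refine le_trans (ENNReal.ofReal_le_ofReal ?_) (h2 _ (M * |t|) hballt hbRt (fun w => ?_) z hz)
  · have h3 : (M * |t|) ^ 2 = M ^ 2 * t ^ 2 := by rw [mul_pow, sq_abs]
    have := h1 t ht1
    rw [h3]
    linarith
  -- the first moments vanish at `t = 0`, so they are `O(t)`
  · have hz0 := setIntegral_inner_eq_zero hr hR hball hbR hsan w
    have hvol := abs_volume_real_polarBody_radialMove_sub_le hS hr hball ht2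
    have hbt : polarBody (radialMove S x t) 0 ⊆ Metric.closedBall 0 (r / 2)⁻¹ :=
      polarBody_subset_closedBall (half_pos hr) hballt
    have hb0 : polarBody (radialMove S x 0) 0 ⊆ Metric.closedBall 0 (r / 2)⁻¹ :=
      (polarBody_subset_closedBall hr hball).trans
        (Metric.closedBall_subset_closedBall (inv_anti₀ (by positivity) (by linarith)))
    have hrw : M * |t| * ‖w‖ = (r / 2)⁻¹ * ((3 * n + 4 * 4 ^ n) *
        volume.real (polarBody (radialMove S x 0) 0) * |t|) * ‖w‖ := by rw [hM]; ring
    rw [hrw]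
    rcases le_total 0 t with h5 | h5
    · have h6 := abs_setIntegral_inner_sub_le hct hc0
        (polarBody_anti (radialMove_mono hS h0 (by norm_num) h5)) hb0 w
      rw [hz0, zero_sub, abs_neg] at h6
      refine h6.trans ?_
      gcongr
      have := neg_le_of_abs_le hvol
      linarith
    · have h6 := abs_setIntegral_inner_sub_le hc0 hct
        (polarBody_anti (radialMove_mono hS h0 (by linarith [(abs_le.1 ht2).1]) h5)) hbt w
      rw [hz0, sub_zero] at h6
      refine h6.trans ?_
      gcongr
      exact le_of_abs_le hvol

end

/-! ### Chords in a fixed direction and the convex kink -/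

section

variable {n : ℕ} {K S : Set (EuclideanSpace ℝ (Fin n))} {x q z : EuclideanSpace ℝ (Fin n)}

/-- A slab meeting each line of direction `x` in a half-open segment of the length of `x`. -/
def slab (x : EuclideanSpace ℝ (Fin n)) : Set (EuclideanSpace ℝ (Fin n)) :=
  {y | 0 ≤ ⟪y, x⟫ ∧ ⟪y, x⟫ < ‖x‖ ^ 2}

lemma measurableSet_slab : MeasurableSet (slab x) := by
  have h1 : MeasurableSet {y : EuclideanSpace ℝ (Fin n) | 0 ≤ ⟪y, x⟫} :=
    measurableSet_le measurable_const (by fun_prop)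
  have h2 : MeasurableSet {y : EuclideanSpace ℝ (Fin n) | ⟪y, x⟫ < ‖x‖ ^ 2} :=
    measurableSet_lt (by fun_prop) measurable_const
  exact h1.inter h2

lemma measurableSet_chordSet {A : Set (EuclideanSpace ℝ (Fin n))} (hA : MeasurableSet A)
    (x : EuclideanSpace ℝ (Fin n)) :
    MeasurableSet {p : EuclideanSpace ℝ (Fin n) × ℝ | p.1 + p.2 • x ∈ A} :=
  (show Measurable fun p : EuclideanSpace ℝ (Fin n) × ℝ => p.1 + p.2 • x by fun_prop) hA

/-- The length of the chord `{s | y + s • x ∈ A}`, in units of `‖x‖`. -/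
noncomputable def chordLength (A : Set (EuclideanSpace ℝ (Fin n)))
    (x y : EuclideanSpace ℝ (Fin n)) : ENNReal :=
  volume {s : ℝ | y + s • x ∈ A}

lemma measurable_chordLength {A : Set (EuclideanSpace ℝ (Fin n))} (hA : MeasurableSet A)
    (x : EuclideanSpace ℝ (Fin n)) : Measurable (chordLength A x) :=
  measurable_measure_prodMk_left (measurableSet_chordSet hA x)

/-- Cavalieri's principle along the direction `x`. -/
lemma volume_eq_lintegral_chordLength {A : Set (EuclideanSpace ℝ (Fin n))} (hA : MeasurableSet A)
    (hx : x ≠ 0) : volume A = ∫⁻ y in slab x, chordLength A x y := by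
  have hx2 : 0 < ‖x‖ ^ 2 := by have := norm_pos_iff.2 hx; positivity
  have hQ := measurableSet_slab (x := x)
  set f : EuclideanSpace ℝ (Fin n) → ENNReal := (slab x).indicator 1 with hf
  set g : EuclideanSpace ℝ (Fin n) → ENNReal := A.indicator 1 with hg
  have hfm : Measurable f := measurable_one.indicator hQ
  have hgm : Measurable g := measurable_one.indicator hA
  have h1 : ∀ y, ∫⁻ s : ℝ, g (y + s • x) = chordLength A x y := fun y => by
    have : (fun s : ℝ => g (y + s • x)) = {s : ℝ | y + s • x ∈ A}.indicator 1 := by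
      ext s; simp [hg, indicator]
    rw [this, lintegral_indicator_one]
    · rfl
    · exact (show Measurable fun s : ℝ => y + s • x by fun_prop) hA
  have h2 : ∀ y, ∫⁻ s : ℝ, f (y - s • x) = 1 := fun y => by
    have : (fun s : ℝ => f (y - s • x)) =
        (Ioc (⟪y, x⟫ / ‖x‖ ^ 2 - 1) (⟪y, x⟫ / ‖x‖ ^ 2)).indicator 1 := by
      ext s
      have : y - s • x ∈ slab x ↔ s ∈ Ioc (⟪y, x⟫ / ‖x‖ ^ 2 - 1) (⟪y, x⟫ / ‖x‖ ^ 2) := by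
        rw [slab, mem_Ioc, le_div_iff₀ hx2, sub_lt_iff_lt_add, div_lt_iff₀ hx2]
        simp only [mem_ofPred_eq, inner_sub_left, inner_smul_left, conj_trivial,
          real_inner_self_eq_norm_sq]
        constructor
        · rintro ⟨h1, h2⟩; constructor <;> linarith
        · rintro ⟨h1, h2⟩; constructor <;> linarith
      by_cases h : s ∈ Ioc (⟪y, x⟫ / ‖x‖ ^ 2 - 1) (⟪y, x⟫ / ‖x‖ ^ 2)
      · rw [indicator_of_mem h, hf, indicator_of_mem (this.2 h)]
        rfl
      · rw [indicator_of_notMem h, hf, indicator_of_notMem (fun h' => h (this.1 h'))]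
    rw [this, lintegral_indicator_one measurableSet_Ioc, Real.volume_Ioc]
    simp
  calc volume A = ∫⁻ y, g y := by rw [hg, lintegral_indicator_one hA]
    _ = ∫⁻ y, ∫⁻ s : ℝ, f (y - s • x) * g y := by
        refine lintegral_congr fun y => ?_
        rw [lintegral_mul_const _ (by fun_prop), h2, one_mul]
    _ = ∫⁻ s : ℝ, ∫⁻ y, f (y - s • x) * g y := by
        refine lintegral_lintegral_swap ?_
        refine Measurable.aemeasurable ?_
        exact (hfm.comp (by fun_prop)).mul (hgm.comp measurable_fst)
    _ = ∫⁻ s : ℝ, ∫⁻ y, f y * g (y + s • x) := by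
        refine lintegral_congr fun s => ?_
        rw [← lintegral_add_right_eq_self (fun y => f (y - s • x) * g y) (s • x)]
        simp
    _ = ∫⁻ y, ∫⁻ s : ℝ, f y * g (y + s • x) := by
        refine lintegral_lintegral_swap ?_
        refine Measurable.aemeasurable ?_
        exact (hfm.comp measurable_snd).mul (hgm.comp (by fun_prop))
    _ = ∫⁻ y, (slab x).indicator (chordLength A x) y := by
        refine lintegral_congr fun y => ?_
        rw [lintegral_const_mul _ (by fun_prop), h1]
        by_cases hy : y ∈ slab x <;> simp [hf, hy]
    _ = _ := lintegral_indicator hQ _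

/-- `y` is a convex combination of `x` and of a point of `conv S`, with coefficient `c` at `x`. -/
def HasApexCoeff (S : Set (EuclideanSpace ℝ (Fin n))) (x : EuclideanSpace ℝ (Fin n)) (c : ℝ)
    (y : EuclideanSpace ℝ (Fin n)) : Prop :=
  0 ≤ c ∧ c ≤ 1 ∧ ∃ g ∈ convexHull ℝ S, y = c • x + (1 - c) • g

lemma exists_hasApexCoeff (hS : S.Nonempty) {y : EuclideanSpace ℝ (Fin n)}
    (hy : y ∈ radialMove S x 0) : ∃ c, HasApexCoeff S x c y := by
  rw [radialMove, add_zero, one_smul, convexHull_insert hS, mem_convexJoin] at hy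
  obtain ⟨x', hx', g, hg, a, b, ha, hb, hab, h⟩ := hy
  rw [mem_singleton_iff.1 hx'] at h
  refine ⟨a, ha, by linarith, g, hg, ?_⟩
  rw [← h, ← hab, add_sub_cancel_left]

lemma HasApexCoeff.add_mem {c : ℝ} {y : EuclideanSpace ℝ (Fin n)} (h : HasApexCoeff S x c y)
    (t : ℝ) : y + (c * t) • x ∈ radialMove S x t := by
  obtain ⟨h0, h1, g, hg, rfl⟩ := h
  have := convex_radialMove (S := S) (x := x) t
    (subset_convexHull ℝ _ (mem_insert _ _) : (1 + t) • x ∈ radialMove S x t)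
    (convexHull_mono (subset_insert _ _) hg : g ∈ radialMove S x t) h0 (sub_nonneg.2 h1)
    (by ring)
  convert this using 1
  module

lemma ofReal_le_chordLength {A : Set (EuclideanSpace ℝ (Fin n))} (hA : Convex ℝ A)
    {y : EuclideanSpace ℝ (Fin n)} {a b : ℝ} (ha : y + a • x ∈ A) (hb : y + b • x ∈ A) :
    ENNReal.ofReal (b - a) ≤ chordLength A x y := by
  rw [← Real.volume_Icc]
  refine measure_mono fun s hs => ?_
  have hc : Convex ℝ {s : ℝ | y + s • x ∈ A} := by
    intro s hs t ht c d hc hd hcd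
    have := hA hs ht hc hd hcd
    simp only [mem_ofPred_eq]
    convert this using 1
    have e : y = (c + d) • y := by rw [hcd, one_smul]
    conv_lhs => rw [e]
    simp only [smul_eq_mul]
    module
  exact hc.ordConnected.out ha hb hs

/-- Chords of the moved polytopes: the mean of the chords for `t` and `-t` is at least the original
chord, with a gain if the upper endpoint has two different coefficients at `x`. -/
lemma two_mul_chordLength_add_le (hfin : S.Finite) (hS : S.Nonempty) (hx : x ≠ 0)
    {y : EuclideanSpace ℝ (Fin n)} {γ t : ℝ} (hγ : 0 ≤ γ) (ht : 0 ≤ t)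
    (hne : 0 < γ → ∃ s : ℝ, y + s • x ∈ radialMove S x 0)
    (htop : ∀ b : ℝ, y + b • x ∈ radialMove S x 0 →
      (∀ s : ℝ, y + s • x ∈ radialMove S x 0 → s ≤ b) →
      ∃ c d, γ ≤ c - d ∧ HasApexCoeff S x c (y + b • x) ∧ HasApexCoeff S x d (y + b • x)) :
    2 * chordLength (radialMove S x 0) x y + ENNReal.ofReal (γ * t) ≤
      chordLength (radialMove S x t) x y + chordLength (radialMove S x (-t)) x y := by
  set I := {s : ℝ | y + s • x ∈ radialMove S x 0} with hI
  have hcl : chordLength (radialMove S x 0) x y = volume I := rfl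
  rcases I.eq_empty_or_nonempty with hemp | hIne
  · rw [hcl, hemp]
    have : γ = 0 := by
      by_contra h
      obtain ⟨s, hs⟩ := hne (lt_of_le_of_ne hγ (Ne.symm h))
      have : s ∈ I := hs
      rw [hemp] at this
      exact this
    simp [this]
  have hcomp := isCompact_radialMove (x := x) hfin 0
  have hIc : IsCompact I := by
    refine Metric.isCompact_of_isClosed_isBounded (hcomp.isClosed.preimage (by fun_prop)) ?_
    obtain ⟨R, hR⟩ := hcomp.isBounded.subset_closedBall y
    have hx0 := norm_pos_iff.2 hx
    refine (Metric.isBounded_closedBall (x := (0 : ℝ)) (r := R / ‖x‖)).subset fun s hs => ?_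
    have := hR hs
    rw [mem_closedBall_iff_norm, add_sub_cancel_left, norm_smul] at this
    rwa [mem_closedBall_zero_iff, le_div_iff₀ hx0]
  -- for `t` the endpoint `b` moves by at least `c * t`, for `-t` by at least `-d * t`; the contributions
  -- `e * t` and `-e * t` of the endpoint `a` cancel
  obtain ⟨b, hb, hbmax⟩ := hIc.exists_isGreatest hIne
  obtain ⟨a, ha, hamin⟩ := hIc.exists_isLeast hIne
  have hab : a ≤ b := hamin hb
  obtain ⟨c, d, hcd, hc, hd⟩ := htop b hb fun s hs => hbmax hs
  obtain ⟨e, he⟩ := exists_hasApexCoeff hS ha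
  have hvol : volume I ≤ ENNReal.ofReal (b - a) := by
    rw [← Real.volume_Icc]
    exact measure_mono fun s hs => ⟨hamin hs, hbmax hs⟩
  have h1 : ENNReal.ofReal ((b + c * t) - (a + e * t)) ≤ chordLength (radialMove S x t) x y :=
    ofReal_le_chordLength (convex_radialMove t)
      (by rw [add_smul, ← add_assoc]; exact he.add_mem t)
      (by rw [add_smul, ← add_assoc]; exact hc.add_mem t)
  have h2 : ENNReal.ofReal ((b + d * -t) - (a + e * -t)) ≤ chordLength (radialMove S x (-t)) x y :=
    ofReal_le_chordLength (convex_radialMove (-t))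
      (by rw [add_smul, ← add_assoc]; exact he.add_mem (-t))
      (by rw [add_smul, ← add_assoc]; exact hd.add_mem (-t))
  calc 2 * chordLength (radialMove S x 0) x y + ENNReal.ofReal (γ * t)
      ≤ 2 * ENNReal.ofReal (b - a) + ENNReal.ofReal (γ * t) := by rw [hcl]; gcongr
    _ = ENNReal.ofReal (2 * (b - a) + γ * t) := by
        rw [ENNReal.ofReal_add (by linarith) (by positivity), ENNReal.ofReal_mul (p := 2) (by norm_num)]
        simp
    _ ≤ ENNReal.ofReal (((b + c * t) - (a + e * t)) + ((b + d * -t) - (a + e * -t))) := by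
        apply ENNReal.ofReal_le_ofReal
        nlinarith
    _ ≤ _ := ENNReal.ofReal_add_le
    _ ≤ _ := add_le_add h1 h2

/-- Near a point `q` of the relative interior of `conv S ∩ {⟨·, ν⟩ = 1}`, every point of the hyperplane
has the coefficient `γ` at `x`, besides the coefficient `0`. -/
lemma hasApexCoeff_of_mem_ball {ν q p : EuclideanSpace ℝ (Fin n)} (hxν : ⟪x, ν⟫ = 1) {δ γ : ℝ}
    (hq : ∀ y ∈ Metric.ball q δ, ⟪y, ν⟫ = 1 → y ∈ convexHull ℝ S) (hγ0 : 0 ≤ γ) (hγ1 : γ ≤ 1 / 2)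
    (hγ2 : γ * ‖q - x‖ ≤ δ / 4) (hpν : ⟪p, ν⟫ = 1) (hpq : ‖p - q‖ < δ / 4) :
    HasApexCoeff S x γ p := by
  have h1γ : 0 < 1 - γ := by linarith
  refine ⟨hγ0, by linarith, (1 - γ)⁻¹ • (p - γ • x), hq _ ?_ ?_, ?_⟩
  · have e : (1 - γ)⁻¹ • (p - γ • x) - q = (1 - γ)⁻¹ • ((p - q) + γ • (q - x)) := by
      have : q = (1 - γ)⁻¹ • ((1 - γ) • q) := by
        rw [smul_smul, inv_mul_cancel₀ h1γ.ne', one_smul]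
      conv_lhs => rw [this]
      rw [← smul_sub]
      congr 1
      module
    rw [mem_ball_iff_norm, e, norm_smul, norm_inv, Real.norm_of_nonneg h1γ.le,
      inv_mul_lt_iff₀ h1γ]
    have : ‖(p - q) + γ • (q - x)‖ ≤ ‖p - q‖ + γ * ‖q - x‖ := by
      refine (norm_add_le _ _).trans ?_
      rw [norm_smul, Real.norm_of_nonneg hγ0]
    have hδ : 0 < δ := by linarith [norm_nonneg (p - q)]
    nlinarith
  · rw [inner_smul_left, inner_sub_left, inner_smul_left, hpν, hxν]
    simp only [conj_trivial, mul_one]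
    exact inv_mul_cancel₀ h1γ.ne'
  · rw [smul_smul, mul_inv_cancel₀ h1γ.ne', one_smul]
    abel

/-- If the facet in the hyperplane `⟨·, ν⟩ = 1` keeps its dimension when its vertex `x` is deleted,
then the volume has a convex kink at `t = 0`. -/
lemma exists_kink (hfin : S.Finite) (hS : S.Nonempty) {ν : EuclideanSpace ℝ (Fin n)}
    (hν : ∀ v ∈ radialMove S x 0, ⟪v, ν⟫ ≤ 1) (hxν : ⟪x, ν⟫ = 1) {q : EuclideanSpace ℝ (Fin n)}
    (hqν : ⟪q, ν⟫ = 1) {δ : ℝ} (hδ : 0 < δ)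
    (hq : ∀ y ∈ Metric.ball q δ, ⟪y, ν⟫ = 1 → y ∈ convexHull ℝ S) :
    ∃ c > 0, ∀ t, 0 ≤ t → 2 * volume.real (radialMove S x 0) + c * t ≤
      volume.real (radialMove S x t) + volume.real (radialMove S x (-t)) := by
  have hx : x ≠ 0 := by rintro rfl; simp at hxν
  have hx2 : 0 < ‖x‖ ^ 2 := by have := norm_pos_iff.2 hx; positivity
  set γ := min (1 / 2) (δ / (4 * (‖q - x‖ + 1))) with hγ
  have hγ0 : 0 < γ := by positivity
  have hγ1 : γ ≤ 1 / 2 := min_le_left _ _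
  have hγ2 : γ * ‖q - x‖ ≤ δ / 4 := by
    have h1 : γ ≤ δ / (4 * (‖q - x‖ + 1)) := min_le_right _ _
    rw [le_div_iff₀ (by positivity)] at h1
    nlinarith
  -- `q + s₀ • x` lies in the middle of the slab
  set s₀ := 1 / 2 - ⟪q, x⟫ / ‖x‖ ^ 2 with hs₀
  have hopen : IsOpen {y : EuclideanSpace ℝ (Fin n) |
      y + (1 - ⟪y, ν⟫) • x ∈ Metric.ball q (δ / 4) ∧ 0 < ⟪y, x⟫ ∧ ⟪y, x⟫ < ‖x‖ ^ 2} := by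
    have h1 : Continuous fun y : EuclideanSpace ℝ (Fin n) => y + (1 - ⟪y, ν⟫) • x := by fun_prop
    have h2 : Continuous fun y : EuclideanSpace ℝ (Fin n) => ⟪y, x⟫ := by fun_prop
    have h3 : IsOpen {y : EuclideanSpace ℝ (Fin n) |
        y + (1 - ⟪y, ν⟫) • x ∈ Metric.ball q (δ / 4)} := Metric.isOpen_ball.preimage h1
    exact h3.and ((isOpen_lt continuous_const h2).and (isOpen_lt h2 continuous_const))
  obtain ⟨ρ, hρ, hball⟩ := Metric.isOpen_iff.1 hopen (q + s₀ • x) (by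
    refine ⟨?_, ?_⟩
    · have : q + s₀ • x + (1 - ⟪q + s₀ • x, ν⟫) • x = q := by
        rw [inner_add_left, inner_smul_left, hqν, hxν, conj_trivial]
        module
      rw [this]
      exact Metric.mem_ball_self (by positivity)
    · have : ⟪q + s₀ • x, x⟫ = ‖x‖ ^ 2 / 2 := by
        rw [inner_add_left, inner_smul_left, conj_trivial, real_inner_self_eq_norm_sq, hs₀]
        field_simp; ring
      rw [this]
      constructor <;> linarith)
  set P := Metric.ball (q + s₀ • x) ρ with hP
  have hPQ : P ⊆ slab x := fun y hy => ⟨(hball hy).2.1.le, (hball hy).2.2⟩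
  have hPpos : 0 < volume.real P :=
    ENNReal.toReal_pos (Metric.measure_ball_pos _ _ hρ).ne' measure_ball_lt_top.ne
  refine ⟨γ * volume.real P, by positivity, fun t ht => ?_⟩
  have hmeas : ∀ t, MeasurableSet (radialMove S x t) := fun t =>
    (isCompact_radialMove hfin t).measurableSet
  have hfinite : ∀ t, volume (radialMove S x t) ≠ ⊤ := fun t =>
    (isCompact_radialMove hfin t).measure_lt_top.ne
  have hpt : ∀ y, 2 * chordLength (radialMove S x 0) x y +
      P.indicator (fun _ => ENNReal.ofReal (γ * t)) y ≤
      chordLength (radialMove S x t) x y + chordLength (radialMove S x (-t)) x y := fun y => by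
    by_cases hy : y ∈ P
    · rw [indicator_of_mem hy]
      set p := y + (1 - ⟪y, ν⟫) • x with hp
      have hpν : ⟪p, ν⟫ = 1 := by
        rw [hp, inner_add_left, inner_smul_left, hxν, conj_trivial]; ring
      have hpq : ‖p - q‖ < δ / 4 := mem_ball_iff_norm.1 (hball hy).1
      have hpS : p ∈ convexHull ℝ S := hq p (mem_ball_iff_norm.2 (by linarith)) hpν
      have hpd : HasApexCoeff S x 0 p := ⟨le_rfl, zero_le_one, p, hpS, by simp⟩
      have hpc : HasApexCoeff S x γ p :=
        hasApexCoeff_of_mem_ball hxν hq hγ0.le hγ1 hγ2 hpν hpq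
      have hpK : p ∈ radialMove S x 0 := convexHull_mono (subset_insert _ _) hpS
      refine two_mul_chordLength_add_le hfin hS hx hγ0.le ht (fun _ => ⟨_, hpK⟩) fun b hb hmax => ?_
      have hb1 : b ≤ 1 - ⟪y, ν⟫ := by
        have := hν _ hb
        rw [inner_add_left, inner_smul_left, hxν, conj_trivial] at this
        linarith
      have hbe : b = 1 - ⟪y, ν⟫ := le_antisymm hb1 (hmax _ hpK)
      rw [hbe]
      exact ⟨γ, 0, by linarith, hpc, hpd⟩
    · rw [indicator_of_notMem hy]
      have := two_mul_chordLength_add_le hfin hS hx (y := y) (γ := 0) le_rfl ht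
        (fun h => absurd h (lt_irrefl _)) (fun b hb _ => by
          obtain ⟨c, hc⟩ := exists_hasApexCoeff hS hb
          exact ⟨c, c, by simp, hc, hc⟩)
      simpa using this
  have hint := lintegral_mono (μ := volume.restrict (slab x)) hpt
  rw [lintegral_add_left ((measurable_chordLength (hmeas 0) x).const_mul 2),
    lintegral_const_mul _ (measurable_chordLength (hmeas 0) x),
    lintegral_add_left (measurable_chordLength (hmeas t) x),
    ← volume_eq_lintegral_chordLength (hmeas 0) hx, ← volume_eq_lintegral_chordLength (hmeas t) hx,
    ← volume_eq_lintegral_chordLength (hmeas (-t)) hx,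
    lintegral_indicator_const measurableSet_ball, Measure.restrict_apply measurableSet_ball,
    inter_eq_self_of_subset_left hPQ] at hint
  have := ENNReal.toReal_mono (ENNReal.add_ne_top.2 ⟨hfinite t, hfinite (-t)⟩) hint
  rw [ENNReal.toReal_add (hfinite t) (hfinite (-t)), ENNReal.toReal_add
    (ENNReal.mul_ne_top (by simp) (hfinite 0))
    (ENNReal.mul_ne_top ENNReal.ofReal_ne_top measure_ball_lt_top.ne), ENNReal.toReal_mul,
    ENNReal.toReal_mul, ENNReal.toReal_ofReal (by positivity)] at this
  simp only [ENNReal.toReal_ofNat] at this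
  simp only [Measure.real]
  calc _ = 2 * (volume (radialMove S x 0)).toReal + γ * t * (volume P).toReal := by ring
    _ ≤ _ := this

end

/-! ### Faces and facets -/

section

variable {n : ℕ} {K S F W : Set (EuclideanSpace ℝ (Fin n))} {x y q z : EuclideanSpace ℝ (Fin n)}

/-- The face of `K` in the hyperplane `⟨·, y⟩ = 1`, for `y ∈ K°`. -/
def faceOf (K : Set (EuclideanSpace ℝ (Fin n))) (y : EuclideanSpace ℝ (Fin n)) :
    Set (EuclideanSpace ℝ (Fin n)) :=
  {z ∈ K | ⟪z, y⟫ = 1}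

lemma isLinearMap_inner_left (y : EuclideanSpace ℝ (Fin n)) :
    IsLinearMap ℝ fun z : EuclideanSpace ℝ (Fin n) => ⟪z, y⟫ :=
  ⟨fun a b => inner_add_left _ _ _, fun c a => by simp [inner_smul_left]⟩

lemma convex_faceOf (hK : Convex ℝ K) (y : EuclideanSpace ℝ (Fin n)) : Convex ℝ (faceOf K y) :=
  hK.inter (convex_hyperplane (isLinearMap_inner_left y) 1)

lemma isCompact_faceOf (hK : IsCompact K) (y : EuclideanSpace ℝ (Fin n)) :
    IsCompact (faceOf K y) :=
  hK.inter_right (isClosed_eq (f := fun z => ⟪z, y⟫) (by fun_prop) continuous_const)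

lemma isExposed_faceOf (hy : y ∈ polarBody K 0) : IsExposed ℝ K (faceOf K y) := by
  rintro ⟨p, hp⟩
  refine ⟨innerSL ℝ y, ?_⟩
  ext z
  simp only [faceOf, innerSL_apply_apply]
  constructor
  · rintro ⟨h1, h2⟩
    refine ⟨h1, fun w hw => ?_⟩
    rw [real_inner_comm z y, h2]
    exact mem_polarBody_zero.1 hy w hw
  · rintro ⟨h1, h2⟩
    have h3 := h2 p hp.1
    have h4 := mem_polarBody_zero.1 hy z h1
    rw [real_inner_comm p y, hp.2] at h3
    exact ⟨h1, by rw [real_inner_comm]; linarith⟩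

lemma convexHull_extremePoints_of_finite (hF : IsCompact F) (hc : Convex ℝ F)
    (hfin : (extremePoints ℝ F).Finite) : convexHull ℝ (extremePoints ℝ F) = F := by
  conv_rhs => rw [← closure_convexHull_extremePoints hF hc]
  exact (hfin.isClosed_convexHull ℝ).closure_eq.symm

lemma extremePoints_faceOf_subset (hy : y ∈ polarBody K 0) :
    extremePoints ℝ (faceOf K y) ⊆ extremePoints ℝ K :=
  (isExposed_faceOf hy).isExtreme.extremePoints_subset_extremePoints

lemma convexHull_subset_span : convexHull ℝ W ⊆ Submodule.span ℝ W :=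
  convexHull_min Submodule.subset_span (Submodule.span ℝ W).convex

lemma sub_smul_mem_vectorSpan (hW : ∀ w ∈ W, ⟪w, y⟫ = 1) (hp : x ∈ W)
    (hz : z ∈ Submodule.span ℝ W) : z - ⟪z, y⟫ • x ∈ vectorSpan ℝ W := by
  induction hz using Submodule.span_induction with
  | mem w hw =>
    rw [hW w hw, one_smul]
    exact vsub_mem_vectorSpan ℝ hw hp
  | zero => simp
  | add a b _ _ ha hb =>
    convert Submodule.add_mem _ ha hb using 1
    rw [inner_add_left]; module
  | smul c a _ ha =>
    convert Submodule.smul_mem _ c ha using 1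
    rw [inner_smul_left, conj_trivial]; module

/-- A subset of a hyperplane off the origin spans one dimension more linearly than affinely. -/
lemma finrank_span_eq_finrank_vectorSpan_add_one (hW : ∀ w ∈ W, ⟪w, y⟫ = 1) (hne : W.Nonempty) :
    Module.finrank ℝ (Submodule.span ℝ W) = Module.finrank ℝ (vectorSpan ℝ W) + 1 := by
  obtain ⟨p, hp⟩ := hne
  have hp0 : p ≠ 0 := by
    rintro rfl
    simpa using hW 0 hp
  have hle : vectorSpan ℝ W ≤ Submodule.span ℝ W := by
    rw [vectorSpan_eq_span_vsub_set_right ℝ hp, Submodule.span_le]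
    rintro _ ⟨w, hw, rfl⟩
    exact Submodule.sub_mem _ (Submodule.subset_span hw) (Submodule.subset_span hp)
  have hker : ∀ z ∈ vectorSpan ℝ W, ⟪z, y⟫ = 0 := fun z hz => by
    rw [vectorSpan_eq_span_vsub_set_right ℝ hp] at hz
    induction hz using Submodule.span_induction with
    | mem w hw =>
      obtain ⟨v, hv, rfl⟩ := hw
      simp [inner_sub_left, hW v hv, hW p hp]
    | zero => simp
    | add a b _ _ ha hb => rw [inner_add_left, ha, hb, add_zero]
    | smul c a _ ha => rw [inner_smul_left, ha, mul_zero]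
  have hsup : vectorSpan ℝ W ⊔ Submodule.span ℝ {p} = Submodule.span ℝ W := by
    refine le_antisymm (sup_le hle (Submodule.span_mono (singleton_subset_iff.2 hp))) fun z hz => ?_
    have h1 := sub_smul_mem_vectorSpan hW hp hz
    rw [← sub_add_cancel z (⟪z, y⟫ • p)]
    exact Submodule.add_mem_sup h1 (Submodule.smul_mem _ _ (Submodule.mem_span_singleton_self p))
  have hinf : vectorSpan ℝ W ⊓ Submodule.span ℝ {p} = ⊥ := by
    rw [Submodule.eq_bot_iff]
    rintro z ⟨h1, h2⟩
    obtain ⟨c, rfl⟩ := Submodule.mem_span_singleton.1 h2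
    have := hker _ h1
    rw [inner_smul_left, hW p hp, conj_trivial, mul_one] at this
    rw [this, zero_smul]
  have := Submodule.finrank_sup_add_finrank_inf_eq (vectorSpan ℝ W) (Submodule.span ℝ {p})
  rwa [hsup, hinf, finrank_bot, add_zero, finrank_span_singleton hp0] at this

lemma span_eq_top_iff_finrank (hW : ∀ w ∈ W, ⟪w, y⟫ = 1) (hne : W.Nonempty) :
    Submodule.span ℝ W = ⊤ ↔ Module.finrank ℝ (vectorSpan ℝ W) + 1 = n := by
  rw [← finrank_span_eq_finrank_vectorSpan_add_one hW hne]
  constructor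
  · intro h; rw [h]; simp
  · intro h
    exact Submodule.eq_top_of_finrank_eq (by simpa using h)

/-- Every facet is the face of a point of the polar body. -/
lemma IsFacet.exists_eq_faceOf (h0 : (0 : EuclideanSpace ℝ (Fin n)) ∈ interior K)
    (hF : IsFacet K F) : ∃ y ∈ polarBody K 0, F = faceOf K y := by
  obtain ⟨hne, hexp, hdim⟩ := hF
  obtain ⟨l, hl⟩ := hexp hne
  obtain ⟨p, hp⟩ := hne
  have hpF := hp
  rw [hl] at hp
  set w := (InnerProductSpace.toDual ℝ (EuclideanSpace ℝ (Fin n))).symm l with hw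
  have hlw : ∀ v, l v = ⟪v, w⟫ := fun v => by
    rw [real_inner_comm, hw, InnerProductSpace.toDual_symm_apply]
  have hn0 : w ≠ 0 := by
    intro hw0
    have hFK : F = K := by
      rw [hl]; ext v; simp [hlw, hw0]
    have htop : affineSpan ℝ K = ⊤ :=
      interior_convexHull_nonempty_iff_affineSpan_eq_top.1
        ⟨0, interior_mono (subset_convexHull ℝ K) h0⟩
    rw [hFK, ← direction_affineSpan, htop, AffineSubspace.direction_top, finrank_top] at hdim
    simp at hdim
  have hpos : 0 < ⟪p, w⟫ := by
    have : Filter.Tendsto (fun ε : ℝ => ε • w) (nhdsWithin 0 (Ioi 0)) (nhds ((0 : ℝ) • w)) :=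
      (Continuous.tendsto (by fun_prop) 0).mono_left nhdsWithin_le_nhds
    rw [zero_smul] at this
    obtain ⟨ε, h1, h2⟩ := ((this.eventually (mem_interior_iff_mem_nhds.1 h0)).and
      self_mem_nhdsWithin).exists
    have h3 := hp.2 _ h1
    rw [hlw, hlw, inner_smul_left, conj_trivial, real_inner_self_eq_norm_sq] at h3
    have h4 : 0 < ε * ‖w‖ ^ 2 := mul_pos h2 (by have := norm_pos_iff.2 hn0; positivity)
    linarith
  refine ⟨(⟪p, w⟫)⁻¹ • w, mem_polarBody_zero.2 fun v hv => ?_, ?_⟩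
  · have := hp.2 v hv
    rw [hlw, hlw] at this
    rw [inner_smul_left, conj_trivial, real_inner_comm v w, inv_mul_le_iff₀ hpos]
    linarith
  · rw [hl]
    ext v
    simp only [faceOf, inner_smul_right, hlw]
    constructor
    · rintro ⟨h1, h2⟩
      refine ⟨h1, ?_⟩
      have h3 := h2 p hp.1
      have h4 := hp.2 v h1
      rw [hlw, hlw] at h4
      rw [le_antisymm h4 h3, inv_mul_cancel₀ hpos.ne']
    · rintro ⟨h1, h2⟩
      refine ⟨h1, fun z hz => ?_⟩
      have h3 := hp.2 z hz
      rw [hlw, hlw] at h3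
      rw [inv_mul_eq_iff_eq_mul₀ hpos.ne', mul_one] at h2
      linarith

/-- A facet of a polytope is the convex hull of finitely many vertices of the polytope, which span
the whole space linearly. -/
lemma IsFacet.extremePoints (hK : IsCompact K) (hc : Convex ℝ K)
    (hfin : (extremePoints ℝ K).Finite) (hF : IsFacet K F) (hy : y ∈ polarBody K 0)
    (hFy : F = faceOf K y) :
    extremePoints ℝ F ⊆ extremePoints ℝ K ∧ convexHull ℝ (extremePoints ℝ F) = F ∧
      Submodule.span ℝ (extremePoints ℝ F) = ⊤ := by
  have h1 : Set.extremePoints ℝ F ⊆ Set.extremePoints ℝ K := by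
    rw [hFy]; exact extremePoints_faceOf_subset hy
  have h2 : convexHull ℝ (Set.extremePoints ℝ F) = F :=
    convexHull_extremePoints_of_finite (by rw [hFy]; exact isCompact_faceOf hK y)
      (by rw [hFy]; exact convex_faceOf hc y) (hfin.subset h1)
  refine ⟨h1, h2, ?_⟩
  have h3 : Submodule.span ℝ F = ⊤ :=
    (span_eq_top_iff_finrank (y := y) (fun w hw => by rw [hFy] at hw; exact hw.2) hF.1).2 hF.2.2
  rw [eq_top_iff, ← h3, Submodule.span_le]
  conv_lhs => rw [← h2]
  exact convexHull_subset_span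

/-- The face of an extreme point `y` of `K°` spans the whole space: `y` could be moved in both directions
`± w` inside `K°` for `w` orthogonal to the face. -/
lemma span_eq_top_of_mem_extremePoints_polarBody {V : Set (EuclideanSpace ℝ (Fin n))}
    (hV : V.Finite) (hKV : K = convexHull ℝ V) (hy : y ∈ extremePoints ℝ (polarBody K 0)) :
    Submodule.span ℝ (faceOf K y) = ⊤ := by
  rw [← Submodule.orthogonal_eq_bot_iff, Submodule.eq_bot_iff]
  intro w hw
  have hort : ∀ v ∈ faceOf K y, ⟪v, w⟫ = 0 := fun v hv =>
    (Submodule.mem_orthogonal _ _).1 hw v (Submodule.subset_span hv)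
  have hsub : V ⊆ K := hKV ▸ subset_convexHull ℝ V
  have key : ∀ w : EuclideanSpace ℝ (Fin n), (∀ v ∈ faceOf K y, ⟪v, w⟫ = 0) →
      ∀ᶠ ε : ℝ in nhds 0, y + ε • w ∈ polarBody K 0 := fun w hw => by
    have : ∀ v ∈ V, ∀ᶠ ε : ℝ in nhds 0, ⟪y + ε • w, v⟫ ≤ 1 := fun v hv => by
      have h1 := mem_polarBody_zero.1 hy.1 v (hsub hv)
      rcases eq_or_lt_of_le h1 with h2 | h2
      · refine Filter.Eventually.of_forall fun ε => ?_
        have := hw v ⟨hsub hv, by rw [real_inner_comm]; exact h2⟩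
        rw [inner_add_left, inner_smul_left, real_inner_comm v w, this, h2]; simp
      · have hcont : Filter.Tendsto (fun ε : ℝ => ⟪y + ε • w, v⟫) (nhds 0)
            (nhds ⟪y + (0 : ℝ) • w, v⟫) := Continuous.tendsto (by fun_prop) 0
        rw [zero_smul, add_zero] at hcont
        exact (hcont.eventually (gt_mem_nhds h2)).mono fun ε h => h.le
    filter_upwards [(Filter.eventually_all_finite hV).2 this] with ε hε
    rw [hKV]
    exact mem_polarBody_convexHull.2 hε
  have h1 := key w hort
  have h2 := key (-w) fun v hv => by rw [inner_neg_right, hort v hv, neg_zero]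
  obtain ⟨ε, ⟨h3, h4⟩, h5⟩ := (((h1.and h2).filter_mono nhdsWithin_le_nhds).and
    (self_mem_nhdsWithin (a := (0 : ℝ)) (s := Ioi 0))).exists
  have h6 := (mem_extremePoints.1 hy).2 _ h3 _ h4
    ⟨1 / 2, 1 / 2, by norm_num, by norm_num, by norm_num, by module⟩
  have h7 : ε • w = 0 := by simpa using h6.1
  exact (smul_eq_zero.1 h7).resolve_left (ne_of_gt h5)

/-- The bipolar theorem. -/
lemma mem_of_forall_mem_polarBody (hc : Convex ℝ K) (hcl : IsClosed K) (h0 : 0 ∈ K)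
    (h : ∀ y ∈ polarBody K 0, ⟪z, y⟫ ≤ 1) : z ∈ K := by
  by_contra hz
  obtain ⟨f, u, h1, h2⟩ := geometric_hahn_banach_closed_point hc hcl hz
  have hu : 0 < u := by simpa using h1 0 h0
  set w := (InnerProductSpace.toDual ℝ (EuclideanSpace ℝ (Fin n))).symm f with hw
  have hfw : ∀ v, f v = ⟪w, v⟫ := fun v => by
    rw [hw, InnerProductSpace.toDual_symm_apply]
  have h3 := h (u⁻¹ • w) (mem_polarBody_zero.2 fun v hv => by
    rw [inner_smul_left, conj_trivial, inv_mul_le_iff₀ hu, ← hfw]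
    linarith [h1 v hv])
  rw [inner_smul_right, inv_mul_le_iff₀ hu, real_inner_comm, ← hfw] at h3
  linarith

/-- A polytope is covered by the pyramids over its facets with apex `0` in the interior: the facet for
`z` is the face of an extreme point of `K°` that maximizes `⟨z, ·⟩`. -/
lemma exists_isFacet_mem_convexHull_insert (hn : 1 ≤ n) {V : Set (EuclideanSpace ℝ (Fin n))}
    (hV : V.Finite) (hKV : K = convexHull ℝ V)
    (h0 : (0 : EuclideanSpace ℝ (Fin n)) ∈ interior K) (hz : z ∈ K) :
    ∃ F, IsFacet K F ∧ z ∈ convexHull ℝ (insert 0 F) := by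
  obtain ⟨r, hr, hball⟩ := Metric.nhds_basis_closedBall.mem_iff.1
    (mem_interior_iff_mem_nhds.1 h0)
  have hKc : IsCompact K := hKV ▸ hV.isCompact_convexHull ℝ
  have hKconv : Convex ℝ K := hKV ▸ convex_convexHull ℝ V
  have hP := isCompact_polarBody hr hball
  -- an extreme point of the polar body at which `⟨z, ·⟩` is maximal
  have hexp : IsExposed ℝ (polarBody K 0) ((innerSL ℝ z).toExposed (polarBody K 0)) :=
    ContinuousLinearMap.toExposed.isExposed
  obtain ⟨y₀, hy₀, hmax₀⟩ := hP.exists_isMaxOn ⟨0, zero_mem_polarBody_zero⟩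
    (f := fun y => ⟪z, y⟫) (by fun_prop)
  have hne : ((innerSL ℝ z).toExposed (polarBody K 0)).Nonempty :=
    ⟨y₀, hy₀, fun w hw => hmax₀ hw⟩
  obtain ⟨y, hy⟩ := (hexp.isCompact hP).extremePoints_nonempty hne
  have hyext : y ∈ extremePoints ℝ (polarBody K 0) :=
    hexp.isExtreme.extremePoints_subset_extremePoints hy
  have hymax : ∀ w ∈ polarBody K 0, ⟪z, w⟫ ≤ ⟪z, y⟫ := fun w hw => hy.1.2 w hw
  have hspan := span_eq_top_of_mem_extremePoints_polarBody hV hKV hyext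
  have hFne : (faceOf K y).Nonempty := by
    rw [nonempty_iff_ne_empty]
    intro hemp
    rw [hemp, Submodule.span_empty] at hspan
    have h1 := finrank_bot ℝ (EuclideanSpace ℝ (Fin n))
    rw [hspan, finrank_top, finrank_euclideanSpace, Fintype.card_fin] at h1
    omega
  refine ⟨faceOf K y, ⟨hFne, isExposed_faceOf hyext.1,
    (span_eq_top_iff_finrank (fun w hw => hw.2) hFne).1 hspan⟩, ?_⟩
  by_cases hz0 : z = 0
  · rw [hz0]; exact subset_convexHull ℝ _ (mem_insert _ _)
  obtain ⟨R, hR, hbR⟩ := hKc.isBounded.subset_closedBall_lt 0 0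
  have hzn := norm_pos_iff.2 hz0
  have hM : 0 < ⟪z, y⟫ := by
    have h1 := hymax ((R⁻¹ / ‖z‖) • z) (closedBall_subset_polarBody hR hbR (by
      rw [mem_closedBall_zero_iff, norm_smul, Real.norm_of_nonneg (by positivity)]
      field_simp; exact le_rfl))
    rw [inner_smul_right, real_inner_self_eq_norm_sq] at h1
    have : 0 < R⁻¹ / ‖z‖ * ‖z‖ ^ 2 := by positivity
    linarith
  have hM1 : ⟪z, y⟫ ≤ 1 := by
    rw [real_inner_comm]; exact mem_polarBody_zero.1 hyext.1 z hz
  rw [mem_convexHull_insert_of_convex (convex_faceOf hKconv y) hFne]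
  refine ⟨(⟪z, y⟫)⁻¹ • z, ⟨mem_of_forall_mem_polarBody hKconv hKc.isClosed (interior_subset h0)
    fun w hw => ?_, ?_⟩, ⟪z, y⟫, hM.le, hM1, ?_⟩
  · rw [inner_smul_left, conj_trivial, inv_mul_le_iff₀ hM, mul_one]
    exact hymax w hw
  · rw [inner_smul_left, conj_trivial, inv_mul_cancel₀ hM.ne']
  · rw [sub_zero, smul_smul, mul_inv_cancel₀ hM.ne', one_smul, zero_add]

lemma finite_setOf_isFacet {V : Set (EuclideanSpace ℝ (Fin n))}
    (hV : V.Finite) (hKV : K = convexHull ℝ V)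
    (h0 : (0 : EuclideanSpace ℝ (Fin n)) ∈ interior K) : {F | IsFacet K F}.Finite := by
  have hKc : IsCompact K := hKV ▸ hV.isCompact_convexHull ℝ
  have hKconv : Convex ℝ K := hKV ▸ convex_convexHull ℝ V
  have hext : extremePoints ℝ K ⊆ V := hKV ▸ extremePoints_convexHull_subset
  refine (hV.powerset.image fun A => convexHull ℝ A).subset fun F hF => ?_
  obtain ⟨y, hy, hFy⟩ := IsFacet.exists_eq_faceOf h0 hF
  obtain ⟨h1, h2, -⟩ := hF.extremePoints hKc hKconv (hV.subset hext) hy hFy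
  exact ⟨_, h1.trans hext, h2⟩

/-- The cones over two distinct faces `F = K ∩ {⟨·, y⟩ = 1}` and `F' = K ∩ {⟨·, y'⟩ = 1}` meet only in
the hyperplane `⟨·, y - y'⟩ = 0`, which is a null set. -/
lemma aedisjoint_of_subset_cone {F' y' A A'} (hy : y ∈ polarBody K 0) (hy' : y' ∈ polarBody K 0)
    (hF : F = faceOf K y) (hF' : F' = faceOf K y') (hne : F ≠ F')
    (hA : ∀ z ∈ A, ∃ c : ℝ, 0 ≤ c ∧ ∃ f ∈ F, z = c • f)
    (hA' : ∀ z ∈ A', ∃ c : ℝ, 0 ≤ c ∧ ∃ f ∈ F', z = c • f) :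
    AEDisjoint volume A A' := by
  have hyy : y - y' ≠ 0 := by
    intro h
    rw [sub_eq_zero.1 h] at hF
    exact hne (hF.trans hF'.symm)
  refine measure_mono_null ?_ (volume_setOf_inner_eq hyy 0)
  rintro z ⟨h1, h2⟩
  obtain ⟨c, hc, f, hf, hz⟩ := hA z h1
  obtain ⟨c', hc', f', hf', hz'⟩ := hA' z h2
  rw [hF] at hf
  rw [hF'] at hf'
  have e1 : ⟪z, y⟫ = c := by rw [hz, inner_smul_left, hf.2, conj_trivial, mul_one]
  have e2 : ⟪z, y'⟫ = c' := by rw [hz', inner_smul_left, hf'.2, conj_trivial, mul_one]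
  have e3 : ⟪z, y'⟫ ≤ c := by
    rw [hz, inner_smul_left, conj_trivial, real_inner_comm]
    have := mem_polarBody_zero.1 hy' f hf.1
    nlinarith
  have e4 : ⟪z, y⟫ ≤ c' := by
    rw [hz', inner_smul_left, conj_trivial, real_inner_comm]
    have := mem_polarBody_zero.1 hy f' hf'.1
    nlinarith
  simp only [mem_ofPred_eq, inner_sub_right]
  linarith

/-- If `x` is not in the span of the other points of `W`, then replacing `x` by `(1 + t) • x` scales the
volume of `conv(0, W)` by `1 + t`. -/
lemma volume_real_convexHull_insert_radialMove (hx : x ∈ W)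
    (hspan : x ∉ Submodule.span ℝ (W \ {x})) {t : ℝ} (ht : -1 < t) :
    volume.real (convexHull ℝ (insert 0 (insert ((1 + t) • x) (W \ {x})))) =
      (1 + t) * volume.real (convexHull ℝ (insert 0 W)) := by
  -- a vector orthogonal to the other vertices
  obtain ⟨u, hu, hxu⟩ : ∃ u, (∀ w ∈ W \ {x}, ⟪w, u⟫ = 0) ∧ ⟪x, u⟫ = 1 := by
    rw [← Submodule.orthogonal_orthogonal (Submodule.span ℝ (W \ {x})),
      Submodule.mem_orthogonal] at hspan
    push Not at hspan
    obtain ⟨u, hu, hux⟩ := hspan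
    refine ⟨(⟪x, u⟫)⁻¹ • u, fun w hw => ?_, ?_⟩
    · rw [inner_smul_right, (Submodule.mem_orthogonal _ _).1 hu w (Submodule.subset_span hw),
        mul_zero]
    · rw [inner_smul_right, inv_mul_cancel₀]
      rwa [real_inner_comm]
  set L : EuclideanSpace ℝ (Fin n) →ₗ[ℝ] EuclideanSpace ℝ (Fin n) :=
    LinearMap.transvection ((innerSL ℝ u : EuclideanSpace ℝ (Fin n) →L[ℝ] ℝ) :
        EuclideanSpace ℝ (Fin n) →ₗ[ℝ] ℝ) (t • x) with hL
  have hLy : ∀ y, L y = y + (⟪y, u⟫ * t) • x := fun y => by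
    simp [hL, LinearMap.transvection, real_inner_comm, smul_smul]
  have hdet : LinearMap.det L = 1 + t := by
    rw [hL, LinearMap.transvection.det]
    simp [real_inner_comm, hxu]
  have himg : convexHull ℝ (insert 0 (insert ((1 + t) • x) (W \ {x}))) =
      L '' convexHull ℝ (insert 0 W) := by
    rw [LinearMap.image_convexHull, image_insert_eq, map_zero]
    congr 2
    conv_rhs => rw [← insert_eq_of_mem hx, ← insert_sdiff_singleton]
    rw [image_insert_eq]
    congr 1
    · rw [hLy, hxu]; module
    · conv_lhs => rw [← image_id (W \ {x})]
      refine image_congr fun w hw => ?_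
      rw [hLy, hu w hw]; simp
  rw [himg, Measure.real, Measure.addHaar_image_linearMap, hdet, ENNReal.toReal_mul,
    ENNReal.toReal_ofReal (abs_nonneg _), abs_of_pos (by linarith), Measure.real]

/-- The cone over a convex set is convex. -/
lemma convexHull_subset_cone (hF : Convex ℝ F)
    (hW : ∀ w ∈ W, ∃ c : ℝ, 0 ≤ c ∧ ∃ f ∈ F, w = c • f) (hz : z ∈ convexHull ℝ W) :
    ∃ c : ℝ, 0 ≤ c ∧ ∃ f ∈ F, z = c • f := by
  have hconv : Convex ℝ {z | ∃ c : ℝ, 0 ≤ c ∧ ∃ f ∈ F, z = c • f} := by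
    rintro _ ⟨c, hc, f, hf, rfl⟩ _ ⟨d, hd, g, hg, rfl⟩ a b ha hb hab
    have h0 : 0 ≤ a * c + b * d := by positivity
    rcases eq_or_lt_of_le h0 with h | h
    · have h1 : a * c = 0 := by nlinarith [mul_nonneg ha hc, mul_nonneg hb hd]
      have h2 : b * d = 0 := by nlinarith [mul_nonneg ha hc, mul_nonneg hb hd]
      exact ⟨0, le_rfl, f, hf, by rw [smul_smul, smul_smul, h1, h2]; simp⟩
    · refine ⟨a * c + b * d, h0, (a * c / (a * c + b * d)) • f + (b * d / (a * c + b * d)) • g,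
        hF hf hg (by positivity) (by positivity) (by rw [← add_div, div_self h.ne']), ?_⟩
      rw [smul_add, smul_smul, smul_smul, smul_smul, smul_smul, mul_div_cancel₀ _ h.ne',
        mul_div_cancel₀ _ h.ne']
  exact convexHull_min hW hconv hz

end

/-! ### Volume of the moved polytope through its facets -/

section

variable {n : ℕ} {K S F W : Set (EuclideanSpace ℝ (Fin n))} {x y q z : EuclideanSpace ℝ (Fin n)}

open scoped Classical in
/-- If the facets through the vertex `x` are simplices, in the sense that `x` is not in the span of
the other vertices of such a facet, then the volume of the polytope is bounded below by an affine
function of `t` which is exact at `t = 0`: the pyramids over the facets, with `x` moved, are contained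
in the moved polytope and stay almost disjoint. -/
lemma volume_real_radialMove_ge (hn : 1 ≤ n) (hfin : S.Finite) (hS : S.Nonempty)
    (h0 : (0 : EuclideanSpace ℝ (Fin n)) ∈ interior (radialMove S x 0))
    (hx : x ∈ extremePoints ℝ (radialMove S x 0)) {𝓕 : Finset (Set (EuclideanSpace ℝ (Fin n)))}
    (h𝓕 : ∀ F, F ∈ 𝓕 ↔ IsFacet (radialMove S x 0) F)
    (hsimp : ∀ F ∈ 𝓕, x ∈ F → x ∉ Submodule.span ℝ (extremePoints ℝ F \ {x}))
    {t : ℝ} (ht : -1 < t) :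
    volume.real (radialMove S x 0) + t * ∑ F ∈ 𝓕 with x ∈ F, (coneVolume F).toReal ≤
      volume.real (radialMove S x t) := by
  set K := radialMove S x 0 with hK
  have hKc : IsCompact K := isCompact_radialMove hfin 0
  have hKconv : Convex ℝ K := convex_radialMove 0
  have hKV : K = convexHull ℝ (insert x S) := by rw [hK, radialMove, add_zero, one_smul]
  have hext : extremePoints ℝ K ⊆ insert x S := hKV ▸ extremePoints_convexHull_subset
  have h0K : (0 : EuclideanSpace ℝ (Fin n)) ∈ K := interior_subset h0
  have h0t := zero_mem_radialMove hS h0K ht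
  have hKt : Convex ℝ (radialMove S x t) := convex_radialMove t
  have hSt : S ⊆ radialMove S x t := (subset_insert _ _).trans (subset_convexHull ℝ _)
  have hface : ∀ F ∈ 𝓕, ∃ y ∈ polarBody K 0, F = faceOf K y ∧
      extremePoints ℝ F ⊆ insert x S ∧ convexHull ℝ (extremePoints ℝ F) = F := fun F hF => by
    have hF' := (h𝓕 F).1 hF
    obtain ⟨y, hy, hFy⟩ := IsFacet.exists_eq_faceOf h0 hF'
    obtain ⟨h1, h2, -⟩ := hF'.extremePoints hKc hKconv ((hfin.insert x).subset hext) hy hFy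
    exact ⟨y, hy, hFy, h1.trans hext, h2⟩
  have hxF : ∀ F ∈ 𝓕, x ∈ F → x ∈ extremePoints ℝ F := fun F hF hxF => by
    obtain ⟨y, hy, hFy, -, -⟩ := hface F hF
    exact inter_extremePoints_subset_extremePoints_of_subset (hFy ▸ fun z hz => hz.1) ⟨hxF, hx⟩
  -- the pyramids over the facets, with the vertex `x` moved
  set G : Set (EuclideanSpace ℝ (Fin n)) → Set (EuclideanSpace ℝ (Fin n)) := fun F =>
    if x ∈ F then convexHull ℝ (insert 0 (insert ((1 + t) • x) (extremePoints ℝ F \ {x})))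
    else convexHull ℝ (insert 0 F) with hG
  have hGsub : ∀ F ∈ 𝓕, G F ⊆ radialMove S x t := fun F hF => by
    obtain ⟨y, hy, hFy, h1, h2⟩ := hface F hF
    by_cases hxF' : x ∈ F
    · simp only [hG, if_pos hxF']
      refine convexHull_min (insert_subset h0t (insert_subset
        (subset_convexHull ℝ _ (mem_insert _ _)) fun w hw => hSt ?_)) hKt
      exact (h1 hw.1).resolve_left hw.2
    · simp only [hG, if_neg hxF']
      refine convexHull_min (insert_subset h0t ?_) hKt
      rw [← h2]
      refine convexHull_min (fun w hw => hSt ?_) hKt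
      refine (h1 hw).resolve_left fun h => hxF' ?_
      exact h ▸ extremePoints_subset hw
  have hGvol : ∀ F ∈ 𝓕, volume.real (G F) =
      (coneVolume F).toReal + if x ∈ F then t * (coneVolume F).toReal else 0 := fun F hF => by
    obtain ⟨y, hy, hFy, h1, h2⟩ := hface F hF
    by_cases hxF' : x ∈ F
    · simp only [hG, if_pos hxF']
      rw [volume_real_convexHull_insert_radialMove (hxF F hF hxF') (hsimp F hF hxF') ht]
      have : convexHull ℝ (insert 0 (extremePoints ℝ F)) = convexHull ℝ (insert 0 F) := by
        refine subset_antisymm (convexHull_mono (insert_subset_insert extremePoints_subset))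
          (convexHull_min (insert_subset (subset_convexHull ℝ _ (mem_insert _ _)) ?_)
            (convex_convexHull ℝ _))
        conv_lhs => rw [← h2]
        exact convexHull_mono (subset_insert _ _)
      rw [this, coneVolume, Measure.real]
      ring
    · simp only [hG, if_neg hxF', add_zero]
      rfl
  have hGcone : ∀ F ∈ 𝓕, ∀ z ∈ G F, ∃ c : ℝ, 0 ≤ c ∧ ∃ f ∈ F, z = c • f := fun F hF z hz => by
    obtain ⟨y, hy, hFy, h1, h2⟩ := hface F hF
    have hFconv : Convex ℝ F := hFy ▸ convex_faceOf hKconv y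
    obtain ⟨p, hp⟩ := ((h𝓕 F).1 hF).1
    have hp0 : ∃ c : ℝ, 0 ≤ c ∧ ∃ f ∈ F, (0 : EuclideanSpace ℝ (Fin n)) = c • f :=
      ⟨0, le_rfl, p, hp, by simp⟩
    have hmem : ∀ w ∈ F, ∃ c : ℝ, 0 ≤ c ∧ ∃ f ∈ F, w = c • f := fun w hw =>
      ⟨1, zero_le_one, w, hw, by simp⟩
    by_cases hxF' : x ∈ F
    · simp only [hG, if_pos hxF'] at hz
      refine convexHull_subset_cone hFconv ?_ hz
      rintro w (rfl | rfl | hw)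
      · exact hp0
      · exact ⟨1 + t, by linarith, x, hxF', rfl⟩
      · exact hmem w (extremePoints_subset hw.1)
    · simp only [hG, if_neg hxF'] at hz
      refine convexHull_subset_cone hFconv ?_ hz
      rintro w (rfl | hw)
      · exact hp0
      · exact hmem w hw
  have hdisj : (𝓕 : Set (Set (EuclideanSpace ℝ (Fin n)))).Pairwise
      (Function.onFun (AEDisjoint volume) G) := fun F hF F' hF' hne => by
    obtain ⟨y, hy, hFy, -, -⟩ := hface F hF
    obtain ⟨y', hy', hFy', -, -⟩ := hface F' hF'
    exact aedisjoint_of_subset_cone hy hy' hFy hFy' hne (hGcone F hF) (hGcone F' hF')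
  have hGnull : ∀ F ∈ 𝓕, NullMeasurableSet (G F) volume := fun F _ => by
    by_cases hxF' : x ∈ F
    · simp only [hG, if_pos hxF']
      exact (convex_convexHull ℝ _).nullMeasurableSet _
    · simp only [hG, if_neg hxF']
      exact (convex_convexHull ℝ _).nullMeasurableSet _
  have hKtfin : volume (radialMove S x t) ≠ ⊤ := (isCompact_radialMove hfin t).measure_lt_top.ne
  have hupper : ∑ F ∈ 𝓕, volume.real (G F) ≤ volume.real (radialMove S x t) := by
    have h1 : ∑ F ∈ 𝓕, volume (G F) ≤ volume (radialMove S x t) := by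
      rw [← measure_biUnion_finset₀ hdisj hGnull]
      exact measure_mono (iUnion₂_subset hGsub)
    have h2 := ENNReal.toReal_mono hKtfin h1
    rwa [ENNReal.toReal_sum fun F hF =>
      measure_ne_top_of_subset (hGsub F hF) hKtfin] at h2
  have hconefin : ∀ F ∈ 𝓕, coneVolume F ≠ ⊤ := fun F hF => by
    obtain ⟨y, hy, hFy, -, -⟩ := hface F hF
    rw [coneVolume]
    refine ((measure_mono (t := K) ?_).trans_lt hKc.measure_lt_top).ne
    refine convexHull_min (insert_subset h0K ?_) hKconv
    rw [hFy]; exact fun z hz => hz.1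
  have hlower : volume.real K ≤ ∑ F ∈ 𝓕, (coneVolume F).toReal := by
    rw [← ENNReal.toReal_sum hconefin]
    refine ENNReal.toReal_mono (ENNReal.sum_ne_top.2 hconefin) ?_
    refine le_trans (measure_mono fun z hz => ?_)
      (measure_biUnion_finset_le 𝓕 fun F => convexHull ℝ (insert 0 F))
    obtain ⟨F, hF, hzF⟩ := exists_isFacet_mem_convexHull_insert hn (hfin.insert x) hKV h0 hz
    exact mem_iUnion₂.2 ⟨F, (h𝓕 F).2 hF, hzF⟩
  rw [Finset.sum_congr rfl hGvol, Finset.sum_add_distrib, ← Finset.sum_filter,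
    ← Finset.mul_sum] at hupper
  linarith

end

/-! ### Translations and existence of the Santaló point -/

section

variable {n : ℕ} {K S F W : Set (EuclideanSpace ℝ (Fin n))} {a x y q z : EuclideanSpace ℝ (Fin n)}

lemma polarBody_vadd (a : EuclideanSpace ℝ (Fin n)) (K : Set (EuclideanSpace ℝ (Fin n)))
    (z : EuclideanSpace ℝ (Fin n)) : polarBody (a +ᵥ K) (a + z) = a +ᵥ polarBody K z := by
  ext y
  rw [mem_vadd_set_iff_neg_vadd_mem]
  simp only [polarBody, mem_ofPred_eq, vadd_eq_add]
  constructor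
  · intro h x hx
    have := h (a + x) ⟨x, hx, rfl⟩
    rwa [show y - (a + z) = -a + y - z by abel, show a + x - (a + z) = x - z by abel] at this
  · rintro h _ ⟨x, hx, rfl⟩
    have := h x hx
    simp only [vadd_eq_add]
    rwa [show y - (a + z) = -a + y - z by abel, show a + x - (a + z) = x - z by abel]

lemma volume_polarBody_vadd (a : EuclideanSpace ℝ (Fin n)) (K : Set (EuclideanSpace ℝ (Fin n)))
    (z : EuclideanSpace ℝ (Fin n)) :
    volume (polarBody (a +ᵥ K) (a + z)) = volume (polarBody K z) := by
  rw [polarBody_vadd, measure_vadd]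

lemma mem_interior_vadd : z ∈ interior (a +ᵥ K) ↔ -a + z ∈ interior K := by
  rw [interior_vadd, mem_vadd_set_iff_neg_vadd_mem, vadd_eq_add]

lemma volumeProduct_vadd (a : EuclideanSpace ℝ (Fin n)) (K : Set (EuclideanSpace ℝ (Fin n))) :
    volumeProduct (a +ᵥ K) = volumeProduct K := by
  refine le_antisymm ?_ ?_
  · refine le_iInf₂ fun z hz => iInf₂_le_of_le (a + z) ?_ ?_
    · rw [mem_interior_vadd]; simpa using hz
    · rw [volume_polarBody_vadd, measure_vadd]
  · refine le_iInf₂ fun z hz => iInf₂_le_of_le (-a + z) (mem_interior_vadd.1 hz) ?_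
    rw [← volume_polarBody_vadd a, measure_vadd]
    simp

lemma extremePoints_vadd_subset (a : EuclideanSpace ℝ (Fin n))
    (K : Set (EuclideanSpace ℝ (Fin n))) :
    extremePoints ℝ (a +ᵥ K) ⊆ a +ᵥ extremePoints ℝ K := by
  rintro _ ⟨⟨x, hx, rfl⟩, h⟩
  refine ⟨x, ⟨hx, fun p hp r hr hxpr => ?_⟩, rfl⟩
  have := h ⟨p, hp, rfl⟩ ⟨r, hr, rfl⟩ ?_
  · simpa using this
  · obtain ⟨s, t, hs, ht, hst, rfl⟩ := hxpr
    refine ⟨s, t, hs, ht, hst, ?_⟩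
    have : a = (s + t) • a := by rw [hst, one_smul]
    simp only [vadd_eq_add]
    conv_rhs => rw [this]
    module

lemma IsPolytope.vadd (h : IsPolytope K) (a : EuclideanSpace ℝ (Fin n)) : IsPolytope (a +ᵥ K) := by
  obtain ⟨S, hS, rfl⟩ := h
  exact ⟨a +ᵥ S, hS.vadd_set, (convexHull_vadd a S).symm⟩

lemma vadd_mem_polytopesAtMost {m : ℕ} (h : K ∈ polytopesAtMost n m)
    (a : EuclideanSpace ℝ (Fin n)) : a +ᵥ K ∈ polytopesAtMost n m := by
  obtain ⟨h1, h2, h3⟩ := h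
  refine ⟨h1.vadd a, ?_, ?_⟩
  · rw [interior_vadd]; exact h2.vadd_set
  · refine le_trans (encard_le_encard (extremePoints_vadd_subset a K)) ?_
    rw [encard_vadd_set]
    exact h3

lemma IsMaximalPolytope.vadd {m : ℕ} (h : IsMaximalPolytope m K)
    (a : EuclideanSpace ℝ (Fin n)) : IsMaximalPolytope m (a +ᵥ K) :=
  ⟨vadd_mem_polytopesAtMost h.1 a, fun L hL => by
    rw [volumeProduct_vadd]; exact h.2 L hL⟩

lemma IsFacet.vadd (h : IsFacet K F) (a : EuclideanSpace ℝ (Fin n)) :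
    IsFacet (a +ᵥ K) (a +ᵥ F) := by
  obtain ⟨h1, h2, h3⟩ := h
  refine ⟨h1.vadd_set, fun _ => ?_, ?_⟩
  · obtain ⟨l, hl⟩ := h2 h1
    refine ⟨l, ?_⟩
    ext z
    rw [mem_vadd_set_iff_neg_vadd_mem, hl]
    simp only [mem_ofPred_eq, mem_vadd_set_iff_neg_vadd_mem, vadd_eq_add, map_add, map_neg]
    refine and_congr_right fun _ => ⟨fun h y hy => ?_, fun h y hy => ?_⟩
    · have := h _ hy
      simp only [map_add, map_neg] at this
      linarith
    · have := h (a + y) (by simpa using hy)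
      simp only [map_add] at this
      linarith
  · have : vectorSpan ℝ (a +ᵥ F) = vectorSpan ℝ F := by
      rw [vectorSpan_vadd]
    rw [this]; exact h3

lemma IsSimplex.vadd (h : IsSimplex F) (a : EuclideanSpace ℝ (Fin n)) : IsSimplex (a +ᵥ F) := by
  obtain ⟨k, T, rfl⟩ := h
  refine ⟨k, ⟨AffineEquiv.constVAdd ℝ _ a ∘ T.points,
    (AffineEquiv.constVAdd ℝ _ a).affineIndependent_iff.2 T.independent⟩, ?_⟩
  rw [← convexHull_vadd, range_comp]
  rfl

/-- Lower semicontinuity of the volume of the polar body in the centre of polarity. -/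
lemma lowerSemicontinuous_volume_polarBody (K : Set (EuclideanSpace ℝ (Fin n))) :
    LowerSemicontinuous fun z => volume (polarBody K z) := by
  intro z a ha
  have hvol : ∀ z, volume (polarBody K z) = volume {w | ∀ x ∈ K, ⟪w, x - z⟫ ≤ 1} := fun z => by
    rw [← measure_preimage_add_right volume z (polarBody K z)]
    congr 1
    ext w
    simp [polarBody]
  have hmeas : MeasurableSet {w | ∀ x ∈ K, ⟪w, x - z⟫ ≤ 1} := by
    have : {w | ∀ x ∈ K, ⟪w, x - z⟫ ≤ 1} = (fun w => w + z) ⁻¹' polarBody K z := by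
      ext w; simp [polarBody]
    rw [this]
    exact ((isClosed_polarBody K z).preimage (by fun_prop)).measurableSet
  simp only [hvol z] at ha
  obtain ⟨C, hCsub, hC, haC⟩ := hmeas.exists_lt_isCompact ha
  -- shrink `C` a little, so that its points satisfy strict inequalities
  obtain ⟨c, hc0, hc1, hac⟩ : ∃ c : ℝ, 0 < c ∧ c < 1 ∧ a < volume (c • C) := by
    have ht : Filter.Tendsto (fun c : ℝ => ENNReal.ofReal (|c ^ n|) * volume C)
        (nhdsWithin 1 (Iio 1)) (nhds (ENNReal.ofReal (|(1 : ℝ) ^ n|) * volume C)) := by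
      refine ENNReal.Tendsto.mul_const ?_ (Or.inr hC.measure_lt_top.ne)
      refine (ENNReal.continuous_ofReal.tendsto _).comp ?_
      exact (Continuous.tendsto (by fun_prop) 1).mono_left nhdsWithin_le_nhds
    rw [one_pow, abs_one, ENNReal.ofReal_one, one_mul] at ht
    obtain ⟨c, ⟨h1, h2⟩, h3⟩ := ((ht.eventually (lt_mem_nhds haC)).and
      (self_mem_nhdsWithin (s := Iio (1 : ℝ)))).and
      (mem_nhdsWithin_of_mem_nhds (lt_mem_nhds (zero_lt_one (α := ℝ)))) |>.exists
    refine ⟨c, h3, h2, ?_⟩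
    rw [Measure.addHaar_smul, finrank_euclideanSpace, Fintype.card_fin]
    exact h1
  obtain ⟨R, hR, hCR⟩ := hC.isBounded.subset_closedBall_lt 0 0
  have hev : ∀ᶠ z' in nhds z, ‖z - z'‖ < (1 - c) / R := by
    have : Filter.Tendsto (fun z' => ‖z - z'‖) (nhds z) (nhds ‖z - z‖) :=
      Continuous.tendsto (by fun_prop) z
    rw [sub_self, norm_zero] at this
    exact this.eventually (gt_mem_nhds (div_pos (by linarith) hR))
  filter_upwards [hev] with z' hz'
  rw [hvol]
  refine hac.trans_le (measure_mono ?_)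
  rintro _ ⟨w, hw, rfl⟩ x hx
  have h1 := hCsub hw x hx
  have h2 : ⟪w, z - z'⟫ ≤ R * ((1 - c) / R) :=
    (real_inner_le_norm _ _).trans (by
      have := mem_closedBall_zero_iff.1 (hCR hw)
      gcongr)
  rw [mul_div_cancel₀ _ hR.ne'] at h2
  have h3 : ⟪c • w, x - z'⟫ = c * ⟪w, x - z⟫ + c * ⟪w, z - z'⟫ := by
    rw [inner_smul_left, conj_trivial, ← mul_add, ← inner_add_right, sub_add_sub_cancel]
  simp only [h3]
  nlinarith

/-- A set that contains a half-cylinder, and hence infinitely many disjoint balls of one radius, has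
infinite volume. -/
lemma volume_eq_top_of_recession {A : Set (EuclideanSpace ℝ (Fin n))} {ρ : ℝ} (hρ : 0 < ρ)
    {u : EuclideanSpace ℝ (Fin n)} (hu : u ≠ 0)
    (h : ∀ w ∈ Metric.ball (0 : EuclideanSpace ℝ (Fin n)) ρ, ∀ s : ℝ, 0 ≤ s → w + s • u ∈ A) :
    volume A = ⊤ := by
  have hu' := norm_pos_iff.2 hu
  set v := (2 * ρ / ‖u‖) • u with hv
  have hvn : ‖v‖ = 2 * ρ := by
    rw [hv, norm_smul, Real.norm_of_nonneg (by positivity)]; field_simp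
  have hdisj : Pairwise (Function.onFun Disjoint
      fun k : ℕ => Metric.ball ((k : ℝ) • v) ρ) := fun i j hij => by
    refine Metric.ball_disjoint_ball ?_
    rw [dist_eq_norm, ← sub_smul, norm_smul, hvn, Real.norm_eq_abs]
    have : (1 : ℝ) ≤ |(i : ℝ) - j| := by
      have h1 : (1 : ℤ) ≤ |(i : ℤ) - j| := Int.one_le_abs (by omega)
      exact_mod_cast h1
    nlinarith
  have hsub : (⋃ k : ℕ, Metric.ball ((k : ℝ) • v) ρ) ⊆ A := by
    refine iUnion_subset fun k w hw => ?_
    have := h (w - (k : ℝ) • v) (by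
      rw [mem_ball_zero_iff]; exact mem_ball_iff_norm.1 hw) (k * (2 * ρ / ‖u‖)) (by positivity)
    rwa [mul_smul, ← hv, sub_add_cancel] at this
  refine top_unique (le_trans ?_ (measure_mono hsub))
  rw [measure_iUnion hdisj fun k => measurableSet_ball]
  simp only [Measure.addHaar_ball_center]
  rw [ENNReal.tsum_const_eq_top_of_ne_zero (Metric.measure_ball_pos _ _ hρ).ne']

/-- The polar body with respect to a point outside the interior has infinite volume: it contains a
half-cylinder in the direction of the outer normal of a separating hyperplane. -/
lemma volume_polarBody_eq_top (hK : IsCompact K) (hc : Convex ℝ K) (hne : (interior K).Nonempty)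
    (hz' : z ∉ interior K) : volume (polarBody K z) = ⊤ := by
  obtain ⟨f, hf⟩ := geometric_hahn_banach_open_point hc.interior isOpen_interior hz'
  have hfK : ∀ x ∈ K, f x ≤ f z := fun x hx => by
    have h1 : x ∈ closure (interior K) := by
      rw [hc.closure_interior_eq_closure_of_nonempty_interior hne]
      exact subset_closure hx
    exact closure_minimal (fun w hw => (hf w hw).le)
      (isClosed_le f.continuous continuous_const) h1
  set u := (InnerProductSpace.toDual ℝ (EuclideanSpace ℝ (Fin n))).symm f with hu
  have hfu : ∀ v, f v = ⟪u, v⟫ := fun v => by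
    rw [hu, InnerProductSpace.toDual_symm_apply]
  have hu0 : u ≠ 0 := by
    intro h0
    obtain ⟨p, hp⟩ := hne
    have := hf p hp
    simp [hfu, h0] at this
  obtain ⟨R, hR, hKR⟩ := hK.isBounded.subset_closedBall_lt 0 z
  have hvol : volume (polarBody K z) = volume {w | ∀ x ∈ K, ⟪w, x - z⟫ ≤ 1} := by
    rw [← measure_preimage_add_right volume z (polarBody K z)]
    congr 1
    ext w
    simp [polarBody]
  rw [hvol]
  refine volume_eq_top_of_recession (inv_pos.2 hR) hu0 fun w hw s hs x hx => ?_
  have h1 : ⟪w, x - z⟫ ≤ R⁻¹ * R := (real_inner_le_norm _ _).trans (by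
    have h2 := (mem_ball_zero_iff.1 hw).le
    have h3 := mem_closedBall_iff_norm.1 (hKR hx)
    gcongr)
  rw [inv_mul_cancel₀ hR.ne'] at h1
  have h4 : ⟪u, x - z⟫ ≤ 0 := by
    rw [inner_sub_right, ← hfu, ← hfu]
    linarith [hfK x hx]
  rw [inner_add_left, inner_smul_left, conj_trivial]
  nlinarith

/-- Existence of the Santaló point: `z ↦ |K^z|` attains its minimum on the compact set `K`, and not at
the boundary, where it is infinite. -/
lemma exists_isSantaloPoint (hK : IsCompact K) (hc : Convex ℝ K) (hne : (interior K).Nonempty) :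
    ∃ s, IsSantaloPoint K s := by
  obtain ⟨p, hp⟩ := hne
  obtain ⟨s, hs, hmin⟩ := LowerSemicontinuousOn.exists_isMinOn ⟨p, interior_subset hp⟩ hK
    ((lowerSemicontinuous_volume_polarBody K).lowerSemicontinuousOn K)
  have hmin' : ∀ z ∈ K, volume (polarBody K s) ≤ volume (polarBody K z) := fun z hz => hmin hz
  refine ⟨s, ?_, fun z hz => hmin' z (interior_subset hz)⟩
  by_contra hsi
  have h1 := hmin' p (interior_subset hp)
  rw [volume_polarBody_eq_top hK hc ⟨p, hp⟩ hsi] at h1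
  have h0 : (0 : EuclideanSpace ℝ (Fin n)) ∈ interior (-p +ᵥ K) := by
    rw [mem_interior_vadd]; simpa using hp
  obtain ⟨r, hr, hball⟩ := Metric.nhds_basis_closedBall.mem_iff.1
    (mem_interior_iff_mem_nhds.1 h0)
  have h2 := (isCompact_polarBody hr hball).measure_lt_top (μ := volume)
  rw [← volume_polarBody_vadd (-p), neg_add_cancel] at h1
  exact absurd h2 (not_lt_of_ge h1)

lemma IsSantaloPoint.vadd (h : IsSantaloPoint K z) : IsSantaloPoint (-z +ᵥ K) 0 := by
  refine ⟨by rw [mem_interior_vadd]; simpa using h.1, fun w hw => ?_⟩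
  rw [mem_interior_vadd, neg_neg] at hw
  have := h.2 _ hw
  rw [← volume_polarBody_vadd (-z), ← volume_polarBody_vadd (-z) K (z + w)] at this
  simpa using this

end

/-! ### The first-order condition at a maximal polytope -/

section

variable {n m : ℕ} {K S F W : Set (EuclideanSpace ℝ (Fin n))} {a x y q z : EuclideanSpace ℝ (Fin n)}

lemma IsPolytope.isCompact (h : IsPolytope K) : IsCompact K := by
  obtain ⟨S, hS, rfl⟩ := h
  exact hS.isCompact_convexHull ℝ

lemma IsPolytope.convex (h : IsPolytope K) : Convex ℝ K := by
  obtain ⟨S, hS, rfl⟩ := h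
  exact convex_convexHull ℝ S

lemma IsPolytope.finite_extremePoints (h : IsPolytope K) : (extremePoints ℝ K).Finite := by
  obtain ⟨S, hS, rfl⟩ := h
  exact hS.subset extremePoints_convexHull_subset

lemma ne_zero_of_mem_extremePoints (hn : 1 ≤ n)
    (h0 : (0 : EuclideanSpace ℝ (Fin n)) ∈ interior K) (hx : x ∈ extremePoints ℝ K) : x ≠ 0 := by
  rintro rfl
  have : Nonempty (Fin n) := ⟨⟨0, hn⟩⟩
  obtain ⟨v, hv⟩ := exists_ne (0 : EuclideanSpace ℝ (Fin n))
  have key : ∀ v : EuclideanSpace ℝ (Fin n), ∀ᶠ ε : ℝ in nhds 0, ε • v ∈ K := fun v => by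
    have : Filter.Tendsto (fun ε : ℝ => ε • v) (nhds 0) (nhds ((0 : ℝ) • v)) :=
      Continuous.tendsto (by fun_prop) 0
    rw [zero_smul] at this
    exact this.eventually (mem_interior_iff_mem_nhds.1 h0)
  obtain ⟨ε, ⟨h3, h4⟩, h5⟩ := ((((key v).and (key (-v))).filter_mono nhdsWithin_le_nhds).and
    (self_mem_nhdsWithin (a := (0 : ℝ)) (s := Ioi 0))).exists
  have h6 := (mem_extremePoints.1 hx).2 _ h3 _ h4
    ⟨1 / 2, 1 / 2, by norm_num, by norm_num, by norm_num, by module⟩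
  exact hv ((smul_eq_zero.1 h6.1).resolve_left (ne_of_gt h5))

lemma radialMove_extremePoints (hK : IsPolytope K) (hx : x ∈ extremePoints ℝ K) :
    radialMove (extremePoints ℝ K \ {x}) x 0 = K := by
  rw [radialMove, add_zero, one_smul, insert_sdiff_singleton, insert_eq_of_mem hx]
  exact convexHull_extremePoints_of_finite hK.isCompact hK.convex hK.finite_extremePoints

lemma nonempty_extremePoints_sdiff (hn : 1 ≤ n) (hK : IsPolytope K)
    (h0 : (0 : EuclideanSpace ℝ (Fin n)) ∈ interior K) (hx : x ∈ extremePoints ℝ K) :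
    (extremePoints ℝ K \ {x}).Nonempty := by
  rw [nonempty_iff_ne_empty]
  intro hemp
  have h1 := radialMove_extremePoints hK hx
  rw [hemp, radialMove, add_zero, one_smul, insert_empty_eq, convexHull_singleton] at h1
  have h2 : (0 : EuclideanSpace ℝ (Fin n)) ∈ ({x} : Set _) := h1 ▸ interior_subset h0
  exact ne_zero_of_mem_extremePoints hn h0 hx (mem_singleton_iff.1 h2).symm

/-- A vertex is strictly separated from the origin and the other vertices. -/
lemma exists_separating_vertex (hn : 1 ≤ n) (hK : IsPolytope K)
    (h0 : (0 : EuclideanSpace ℝ (Fin n)) ∈ interior K) (hx : x ∈ extremePoints ℝ K) :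
    ∃ q : EuclideanSpace ℝ (Fin n), (∀ v ∈ extremePoints ℝ K \ {x}, ⟪q, v⟫ ≤ 1) ∧ 1 < ⟪q, x⟫ := by
  set S := extremePoints ℝ K \ {x} with hS
  have hSfin : S.Finite := hK.finite_extremePoints.subset sdiff_subset
  set C := convexHull ℝ (insert 0 S) with hC
  have hCK : C ⊆ K := convexHull_min (insert_subset (interior_subset h0) fun v hv =>
    extremePoints_subset hv.1) hK.convex
  have hxC : x ∉ C := fun h => by
    have h1 : x ∈ extremePoints ℝ C :=
      inter_extremePoints_subset_extremePoints_of_subset hCK ⟨h, hx⟩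
    rcases extremePoints_convexHull_subset h1 with h2 | h2
    · exact ne_zero_of_mem_extremePoints hn h0 hx h2
    · exact h2.2 rfl
  obtain ⟨f, u, h1, h2⟩ := geometric_hahn_banach_closed_point (convex_convexHull ℝ _)
    ((hSfin.insert 0).isClosed_convexHull ℝ) hxC
  have hu : 0 < u := by simpa using h1 0 (subset_convexHull ℝ _ (mem_insert _ _))
  set w := (InnerProductSpace.toDual ℝ (EuclideanSpace ℝ (Fin n))).symm f with hw
  have hfw : ∀ v, f v = ⟪w, v⟫ := fun v => by
    rw [hw, InnerProductSpace.toDual_symm_apply]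
  refine ⟨u⁻¹ • w, fun v hv => ?_, ?_⟩
  · rw [inner_smul_left, conj_trivial, inv_mul_le_iff₀ hu, ← hfw, mul_one]
    exact (h1 v (subset_convexHull ℝ _ (mem_insert_of_mem _ hv))).le
  · rw [inner_smul_left, conj_trivial, lt_inv_mul_iff₀ hu, ← hfw, mul_one]
    exact h2

/-- If `W` spans and lies in the hyperplane `⟨·, y⟩ = 1`, then `conv W` has non-empty interior
relative to this hyperplane. -/
lemma exists_ball_inter_subset_convexHull (hn : 1 ≤ n) (hW : ∀ w ∈ W, ⟪w, y⟫ = 1)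
    (hspan : Submodule.span ℝ W = ⊤) :
    ∃ q : EuclideanSpace ℝ (Fin n), ⟪q, y⟫ = 1 ∧ ∃ δ > 0, ∀ z ∈ Metric.ball q δ, ⟪z, y⟫ = 1 →
      z ∈ convexHull ℝ W := by
  have : Nonempty (Fin n) := ⟨⟨0, hn⟩⟩
  have hne : W.Nonempty := by
    rw [nonempty_iff_ne_empty]
    rintro rfl
    rw [Submodule.span_empty] at hspan
    exact bot_ne_top hspan
  have hy0 : y ≠ 0 := by
    rintro rfl
    obtain ⟨w, hw⟩ := hne
    simpa using hW w hw
  have hint : (interior (convexHull ℝ (insert 0 W))).Nonempty := by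
    rw [interior_convexHull_nonempty_iff_affineSpan_eq_top, ← SetLike.coe_set_eq,
      affineSpan_insert_zero, hspan]
    rfl
  -- an interior point off the null set `⟨·, y⟩ = 0`
  obtain ⟨p, hp, hpy⟩ : ∃ p ∈ interior (convexHull ℝ (insert 0 W)), ⟪p, y⟫ ≠ 0 := by
    by_contra! h
    have h1 := measure_mono_null (μ := volume) (fun p hp => h p hp) (volume_setOf_inner_eq hy0 0)
    exact (isOpen_interior.measure_pos volume hint).ne' h1
  have hWconv : ∀ f ∈ convexHull ℝ W, ⟪f, y⟫ = 1 := fun f hf =>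
    convexHull_min (fun w hw => hW w hw) (convex_hyperplane (isLinearMap_inner_left y) 1) hf
  have hmem : ∀ v ∈ convexHull ℝ (insert 0 W), v = ⟪v, y⟫ • (0 : EuclideanSpace ℝ (Fin n)) ∨
      0 < ⟪v, y⟫ ∧ ∃ f ∈ convexHull ℝ W, v = ⟪v, y⟫ • f := fun v hv => by
    have h1 : convexHull ℝ (insert 0 W) = convexHull ℝ (insert 0 (convexHull ℝ W)) := by
      rw [convexHull_insert hne, convexHull_insert hne.convexHull,
        (convex_convexHull ℝ W).convexHull_eq]
    rw [h1, mem_convexHull_insert_of_convex (convex_convexHull ℝ W) hne.convexHull] at hv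
    obtain ⟨f, hf, θ, h2, h3, rfl⟩ := hv
    simp only [sub_zero, zero_add, inner_smul_left, hWconv f hf, conj_trivial, mul_one]
    rcases eq_or_lt_of_le h2 with h4 | h4
    · left; rw [← h4]; simp
    · exact Or.inr ⟨h4, f, hf, rfl⟩
  set c := ⟪p, y⟫ with hc
  have hc0 : 0 < c := by
    rcases hmem p (interior_subset hp) with h | h
    · rw [smul_zero] at h
      exact absurd (by rw [hc, h, inner_zero_left]) hpy
    · exact h.1
  obtain ⟨δ, hδ, hball⟩ := Metric.isOpen_iff.1 isOpen_interior p hp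
  refine ⟨c⁻¹ • p, ?_, δ / c, by positivity, fun z hz hzy => ?_⟩
  · rw [inner_smul_left, conj_trivial, inv_mul_cancel₀ hc0.ne']
  · have h1 : c • z ∈ Metric.ball p δ := by
      rw [mem_ball_iff_norm] at *
      have : c • z - p = c • (z - c⁻¹ • p) := by
        rw [smul_sub, smul_smul, mul_inv_cancel₀ hc0.ne', one_smul]
      rw [this, norm_smul, Real.norm_of_nonneg hc0.le]
      rwa [lt_div_iff₀' hc0] at hz
    have h2 : ⟪c • z, y⟫ = c := by rw [inner_smul_left, hzy, conj_trivial, mul_one]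
    rcases hmem _ (interior_subset (hball h1)) with h | ⟨-, f, hf, h⟩
    · rw [smul_zero] at h
      rw [h, inner_zero_left] at h2
      exact absurd h2 hc0.ne
    · rw [h2] at h
      rw [smul_right_injective _ hc0.ne' h]
      exact hf

lemma isSimplex_of_linearIndependent (hfin : W.Finite) (hne : W.Nonempty)
    (hW : ∀ x ∈ W, x ∉ Submodule.span ℝ (W \ {x})) : IsSimplex (convexHull ℝ W) := by
  have hli : LinearIndependent ℝ ((↑) : W → EuclideanSpace ℝ (Fin n)) := by
    rw [linearIndependent_iff_notMem_span]
    intro i hi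
    refine hW i i.2 (Submodule.span_mono ?_ hi)
    rintro _ ⟨j, hj, rfl⟩
    exact ⟨j.2, fun h => hj.2 (Subtype.ext h)⟩
  have := hfin.to_subtype
  have := hne.to_subtype
  obtain ⟨k, hk⟩ := Nat.exists_eq_succ_of_ne_zero (Nat.card_pos (α := W)).ne'
  let e : W ≃ Fin (k + 1) := Finite.equivFinOfCardEq hk
  refine ⟨k, ⟨fun i => (e.symm i : EuclideanSpace ℝ (Fin n)),
    (hli.affineIndependent ℝ).comp_embedding e.symm.toEmbedding⟩, ?_⟩
  have hrange : range (((↑) : W → EuclideanSpace ℝ (Fin n)) ∘ e.symm) = W := by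
    rw [e.symm.surjective.range_comp, Subtype.range_coe]
  exact congrArg (convexHull ℝ) hrange.symm

/-- The consequence of maximality along the radial motion of a vertex. The moved polytope is again in
the class, and the infimum in its volume product is controlled by the envelope estimate. -/
lemma IsMaximalPolytope.exists_mul_le (hn : 1 ≤ n) (hK : IsMaximalPolytope m K)
    (hsan : IsSantaloPoint K 0) (hx : x ∈ extremePoints ℝ K) :
    ∃ C ε : ℝ, 0 < ε ∧ ε ≤ 1 / 2 ∧ 0 ≤ C ∧ ∀ t, |t| ≤ ε →
      volume.real (radialMove (extremePoints ℝ K \ {x}) x t) *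
        (volume.real (polarBody K 0) - n * (coneVolume (dualFacet K x)).toReal * t - C * t ^ 2) ≤
      volume.real K * volume.real (polarBody K 0) := by
  have hpoly := hK.1.1
  have h0 := hsan.1
  set S := extremePoints ℝ K \ {x} with hS
  have hSfin : S.Finite := hpoly.finite_extremePoints.subset sdiff_subset
  have hSne : S.Nonempty := nonempty_extremePoints_sdiff hn hpoly h0 hx
  have hKS : radialMove S x 0 = K := radialMove_extremePoints hpoly hx
  obtain ⟨q, hqS, hqx⟩ := exists_separating_vertex hn hpoly h0 hx
  obtain ⟨C, ε, hε, hε1, hC, h⟩ := exists_volume_polarBody_radialMove_ge hSne hSfin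
    (by rw [hKS]; exact hsan) (ne_zero_of_mem_extremePoints hn h0 hx) hqS hqx
  rw [hKS] at h
  refine ⟨C, ε, hε, hε1, hC, fun t ht => ?_⟩
  obtain ⟨r, hr, hball⟩ := Metric.nhds_basis_closedBall.mem_iff.1
    (mem_interior_iff_mem_nhds.1 h0)
  have hballt := closedBall_subset_radialMove hSne hr (by rw [hKS]; exact hball) (ht.trans hε1)
  have hmem : radialMove S x t ∈ polytopesAtMost n m := by
    refine ⟨⟨_, hSfin.insert _, rfl⟩, ⟨0, interior_mono hballt ?_⟩, ?_⟩
    · rw [mem_interior_iff_mem_nhds]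
      exact Metric.closedBall_mem_nhds _ (half_pos hr)
    · calc (vertices (radialMove S x t)).encard ≤ (insert ((1 + t) • x) S).encard :=
            encard_le_encard extremePoints_convexHull_subset
        _ ≤ S.encard + 1 := encard_insert_le _ _
        _ = (extremePoints ℝ K).encard := encard_sdiff_singleton_add_one hx
        _ ≤ m := hK.1.2.2
  set B := volume.real (polarBody K 0) - n * (coneVolume (dualFacet K x)).toReal * t - C * t ^ 2
    with hB
  have hKtfin : volume (radialMove S x t) ≠ ⊤ := (isCompact_radialMove hSfin t).measure_lt_top.ne
  have hKfin : volume K ≠ ⊤ := hpoly.isCompact.measure_lt_top.ne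
  have hPfin : volume (polarBody K 0) ≠ ⊤ := (isCompact_polarBody hr hball).measure_lt_top.ne
  have h1 : volume (radialMove S x t) * ENNReal.ofReal B ≤ volume K * volume (polarBody K 0) :=
    calc _ ≤ volumeProduct (radialMove S x t) := le_iInf₂ fun z hz => by
          gcongr; exact h t ht z hz
      _ ≤ volumeProduct K := hK.2 _ hmem
      _ ≤ _ := iInf₂_le 0 h0
  have h2 := ENNReal.toReal_mono (ENNReal.mul_ne_top hKfin hPfin) h1
  rw [ENNReal.toReal_mul, ENNReal.toReal_mul, ENNReal.toReal_ofReal'] at h2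
  refine le_trans ?_ h2
  exact mul_le_mul_of_nonneg_left (le_max_left _ _) ENNReal.toReal_nonneg

/-- No vertex of a facet of a maximal polytope lies in the span of the other vertices of the facet. The
opposite motions `t` and `-t` have polar expansions that cancel to first order, while the volume would
gain a convex kink. -/
lemma IsMaximalPolytope.notMem_span (hn : 1 ≤ n) (hK : IsMaximalPolytope m K)
    (hsan : IsSantaloPoint K 0) (hF : IsFacet K F) (hx : x ∈ extremePoints ℝ F) :
    x ∉ Submodule.span ℝ (extremePoints ℝ F \ {x}) := by
  intro hspan
  have hpoly := hK.1.1
  have h0 := hsan.1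
  obtain ⟨y, hy, hFy⟩ := IsFacet.exists_eq_faceOf h0 hF
  obtain ⟨hWK, -, hWspan⟩ := hF.extremePoints hpoly.isCompact hpoly.convex
    hpoly.finite_extremePoints hy hFy
  have hxK := hWK hx
  set S := extremePoints ℝ K \ {x} with hS
  have hSfin : S.Finite := hpoly.finite_extremePoints.subset sdiff_subset
  have hSne : S.Nonempty := nonempty_extremePoints_sdiff hn hpoly h0 hxK
  have hKS : radialMove S x 0 = K := radialMove_extremePoints hpoly hxK
  have hWy : ∀ w ∈ extremePoints ℝ F, ⟪w, y⟫ = 1 := fun w hw => by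
    have := extremePoints_subset hw
    rw [hFy] at this
    exact this.2
  have hspan' : Submodule.span ℝ (extremePoints ℝ F \ {x}) = ⊤ := by
    rw [eq_top_iff, ← hWspan, Submodule.span_le]
    intro w hw
    by_cases hwx : w = x
    · rw [hwx]; exact hspan
    · exact Submodule.subset_span ⟨hw, hwx⟩
  obtain ⟨q, hqy, δ, hδ, hq⟩ := exists_ball_inter_subset_convexHull hn
    (fun w hw => hWy w hw.1) hspan'
  obtain ⟨c, hc, hkink⟩ := exists_kink (x := x) hSfin hSne (ν := y)
    (fun v hv => by
      rw [hKS] at hv; rw [real_inner_comm]; exact mem_polarBody_zero.1 hy v hv)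
    (hWy x hx) hqy hδ
    (fun z hz hzy => convexHull_mono (sdiff_subset_sdiff_left hWK) (hq z hz hzy))
  obtain ⟨C, ε, hε, hε1, hC, hmax⟩ := hK.exists_mul_le hn hsan hxK
  have hlip := fun t (ht : |t| ≤ 1 / 2) => abs_volume_real_radialMove_sub_le (x := x) hSfin hSne
    (by rw [hKS]; exact interior_subset h0) ht
  rw [hKS] at hkink
  simp only [hKS] at hlip
  rw [← hS] at hmax
  obtain ⟨r, hr, hball⟩ := Metric.nhds_basis_closedBall.mem_iff.1
    (mem_interior_iff_mem_nhds.1 h0)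
  obtain ⟨R, hR, hbR⟩ := hpoly.isCompact.isBounded.subset_closedBall_lt 0 0
  have hp0 : 0 < volume.real (polarBody K 0) := volume_real_polarBody_pos hr hR hball hbR
  set p := volume.real (polarBody K 0) with hp
  set D := (coneVolume (dualFacet K x)).toReal with hD
  have hD0 : 0 ≤ D := ENNReal.toReal_nonneg
  set v := volume.real K with hv
  have hv0 : 0 ≤ v := measureReal_nonneg
  set M := ((n : ℝ) + 4 ^ n) * v with hM
  have hM0 : 0 ≤ M := by positivity
  have hzero : c * p = 0 := by
    refine eq_zero_of_forall_mul_le_sq (C := 2 * n * D * M + 2 * C * (v + M)) hε fun t ht => ?_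
    -- for `t ≤ 0` the left-hand side is not positive
    rcases le_total t 0 with hneg | hpos
    · have h1 : c * p * t ≤ 0 := mul_nonpos_of_nonneg_of_nonpos (by positivity) hneg
      exact h1.trans (by positivity)
    have ht2 : |t| ≤ 1 / 2 := ht.le.trans hε1
    have h1 := hmax t ht.le
    have h2 := hmax (-t) (by rw [abs_neg]; exact ht.le)
    have h3 := hkink t hpos
    have h4 := hlip t ht2
    have h5 := hlip (-t) (by rwa [abs_neg])
    rw [abs_neg] at h5
    rw [abs_of_nonneg hpos] at h4 h5 ht2
    obtain ⟨h6, h7⟩ := abs_le.1 h4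
    obtain ⟨h8, h9⟩ := abs_le.1 h5
    set a := volume.real (radialMove S x t) with ha
    set b := volume.real (radialMove S x (-t)) with hb
    have h10 : (a - b) * (n * D * t) ≤ (2 * M * t) * (n * D * t) := by
      have : 0 ≤ n * D * t := by positivity
      gcongr; linarith
    have h11 : (a + b) * (C * t ^ 2) ≤ (2 * (v + M)) * (C * t ^ 2) := by
      have : M * t ≤ M := by nlinarith
      gcongr; linarith
    have h12 : (2 * v + c * t) * p ≤ (a + b) * p := by gcongr
    linarith
  exact absurd hzero (by positivity)

/-- The first-order condition at a vertex of a maximal polytope. The lower bound of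
`volume_real_radialMove_ge` is available since the facets are simplices by
`IsMaximalPolytope.notMem_span`. -/
lemma IsMaximalPolytope.volume_mul_tsum_coneVolume (hn : 1 ≤ n) (hK : IsMaximalPolytope m K)
    (hsan : IsSantaloPoint K 0) (hx : x ∈ extremePoints ℝ K) :
    volume (polarBody K 0) *
        ∑' F : {F : Set (EuclideanSpace ℝ (Fin n)) // IsFacet K F ∧ x ∈ F},
          coneVolume (F : Set (EuclideanSpace ℝ (Fin n))) =
      (n : ENNReal) * volume K * coneVolume (dualFacet K x) := by
  classical
  have hpoly := hK.1.1
  have h0 := hsan.1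
  set S := extremePoints ℝ K \ {x} with hS
  have hSfin : S.Finite := hpoly.finite_extremePoints.subset sdiff_subset
  have hSne : S.Nonempty := nonempty_extremePoints_sdiff hn hpoly h0 hx
  have hKS : radialMove S x 0 = K := radialMove_extremePoints hpoly hx
  have hfacets : {F | IsFacet K F}.Finite := by
    obtain ⟨V, hV, hKV⟩ := hpoly
    exact finite_setOf_isFacet hV hKV h0
  set 𝓕 := hfacets.toFinset with h𝓕
  have hmem𝓕 : ∀ F, F ∈ 𝓕 ↔ IsFacet K F := fun F => by simp [h𝓕]
  have hsum : ∑' F : {F : Set (EuclideanSpace ℝ (Fin n)) // IsFacet K F ∧ x ∈ F},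
      coneVolume (F : Set (EuclideanSpace ℝ (Fin n))) = ∑ F ∈ 𝓕 with x ∈ F, coneVolume F := by
    rw [← Finset.tsum_subtype]
    have hset : {F : Set (EuclideanSpace ℝ (Fin n)) | IsFacet K F ∧ x ∈ F} =
        {F | F ∈ 𝓕.filter fun F => x ∈ F} := by
      ext F; simp [hmem𝓕]
    exact tsum_congr_set_coe coneVolume hset
  obtain ⟨r, hr, hball⟩ := Metric.nhds_basis_closedBall.mem_iff.1
    (mem_interior_iff_mem_nhds.1 h0)
  have hKfin : volume K ≠ ⊤ := hpoly.isCompact.measure_lt_top.ne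
  have hPfin : volume (polarBody K 0) ≠ ⊤ := (isCompact_polarBody hr hball).measure_lt_top.ne
  have hDfin : coneVolume (dualFacet K x) ≠ ⊤ := by
    refine ((measure_mono ?_).trans_lt hPfin.lt_top).ne
    exact convexHull_min (insert_subset zero_mem_polarBody_zero fun y hy => hy.1)
      convex_polarBody_zero
  have hFfin : ∀ F ∈ 𝓕.filter fun F => x ∈ F, coneVolume F ≠ ⊤ := fun F hF => by
    refine ((measure_mono ?_).trans_lt hKfin.lt_top).ne
    exact convexHull_min (insert_subset (interior_subset h0)
      ((hmem𝓕 F).1 (Finset.mem_filter.1 hF).1).2.1.subset) hpoly.convex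
  obtain ⟨C, ε, hε, hε1, hC, hmax⟩ := hK.exists_mul_le hn hsan hx
  have hlip := fun t (ht : |t| ≤ 1 / 2) => abs_volume_real_radialMove_sub_le (x := x) hSfin hSne
    (by rw [hKS]; exact interior_subset h0) ht
  have hvol := fun t (ht : -1 < t) => volume_real_radialMove_ge (x := x) (𝓕 := 𝓕) hn hSfin hSne
    (by rw [hKS]; exact h0) (by rw [hKS]; exact hx) (by rw [hKS]; exact hmem𝓕)
    (fun F hF hxF => hK.notMem_span hn hsan ((hmem𝓕 F).1 hF)
      (inter_extremePoints_subset_extremePoints_of_subset ((hmem𝓕 F).1 hF).2.1.subset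
        ⟨hxF, hx⟩)) ht
  simp only [hKS] at hlip hvol
  rw [← hS] at hmax
  set p := volume.real (polarBody K 0) with hp
  have hp0 : 0 ≤ p := measureReal_nonneg
  set D := (coneVolume (dualFacet K x)).toReal with hD
  have hD0 : 0 ≤ D := ENNReal.toReal_nonneg
  set v := volume.real K with hv
  have hv0 : 0 ≤ v := measureReal_nonneg
  set V := ∑ F ∈ 𝓕 with x ∈ F, (coneVolume F).toReal with hV
  set M := ((n : ℝ) + 4 ^ n) * v with hM
  have hM0 : 0 ≤ M := by positivity
  have hzero : V * p - n * v * D = 0 := by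
    refine eq_zero_of_forall_mul_le_sq (C := n * D * M + C * (v + M)) hε fun t ht => ?_
    have ht2 : |t| ≤ 1 / 2 := ht.le.trans hε1
    have h1 := hmax t ht.le
    have h2 := hlip t ht2
    have h3 := hvol t (by linarith [(abs_le.1 ht2).1])
    set a := volume.real (radialMove S x t) with ha
    have h4 : (v + t * V) * p ≤ a * p := by gcongr
    have h5 : (a - v) * t ≤ M * t ^ 2 := by
      calc (a - v) * t ≤ |(a - v) * t| := le_abs_self _
        _ = |a - v| * |t| := abs_mul _ _
        _ ≤ M * |t| * |t| := by gcongr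
        _ = M * t ^ 2 := by rw [mul_assoc, ← sq, sq_abs]
    have h6 : n * D * ((a - v) * t) ≤ n * D * (M * t ^ 2) := by gcongr
    have h7 : a * (C * t ^ 2) ≤ (v + M) * (C * t ^ 2) := by
      have : M * |t| ≤ M := by nlinarith
      have := (abs_le.1 h2).2
      gcongr; linarith
    linarith
  have hSumfin : ∑ F ∈ 𝓕 with x ∈ F, coneVolume F ≠ ⊤ := ENNReal.sum_ne_top.2 hFfin
  rw [hsum, ← ENNReal.toReal_eq_toReal_iff' (ENNReal.mul_ne_top hPfin hSumfin)
    (ENNReal.mul_ne_top (ENNReal.mul_ne_top (by simp) hKfin) hDfin), ENNReal.toReal_mul,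
    ENNReal.toReal_mul, ENNReal.toReal_mul, ENNReal.toReal_sum hFfin, ENNReal.toReal_natCast]
  simp only [Measure.real] at hp hv
  rw [← hp, ← hV, ← hv, ← hD]
  linarith

lemma IsMaximalPolytope.isSimplex_of_isFacet (hn : 1 ≤ n) (hK : IsMaximalPolytope m K)
    (hF : IsFacet K F) : IsSimplex F := by
  -- translate the Santaló point to the origin
  obtain ⟨s, hs⟩ := exists_isSantaloPoint hK.1.1.isCompact hK.1.1.convex hK.1.2.1
  have hK' := hK.vadd (-s)
  have hsan := hs.vadd
  have hF' := hF.vadd (-s)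
  have hpoly' := hK'.1.1
  obtain ⟨y, hy, hFy⟩ := IsFacet.exists_eq_faceOf hsan.1 hF'
  obtain ⟨h1, h2, -⟩ := hF'.extremePoints hpoly'.isCompact hpoly'.convex
    hpoly'.finite_extremePoints hy hFy
  have hne : (extremePoints ℝ (-s +ᵥ F)).Nonempty := by
    rw [nonempty_iff_ne_empty]
    intro hemp
    rw [hemp, convexHull_empty] at h2
    exact hF'.1.ne_empty h2.symm
  have h3 := isSimplex_of_linearIndependent (hpoly'.finite_extremePoints.subset h1) hne
    fun x hx => hK'.notMem_span hn hsan hF' hx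
  rw [h2] at h3
  have h4 := h3.vadd s
  rwa [vadd_vadd, add_neg_cancel, zero_vadd] at h4

end

end VolProd

theorem theorem3p4 (n m : ℕ) (hn : 1 ≤ n) (hm : n + 1 ≤ m)
    (K : Set (EuclideanSpace ℝ (Fin n))) (hK : VolProd.IsMaximalPolytope m K) :
    VolProd.IsSimplicialPolytope K ∧
      (VolProd.IsSantaloPoint K 0 →
        ∀ x ∈ VolProd.vertices K,
          volume (VolProd.polarBody K 0) *
              ∑' F : {F : Set (EuclideanSpace ℝ (Fin n)) // VolProd.IsFacet K F ∧ x ∈ F},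
                VolProd.coneVolume (F : Set (EuclideanSpace ℝ (Fin n))) =
            (n : ENNReal) * volume K * VolProd.coneVolume (VolProd.dualFacet K x)) := by
  exact ⟨⟨hK.1.1, fun F hF => hK.isSimplex_of_isFacet hn hF⟩,
    fun hsan x hx => hK.volume_mul_tsum_coneVolume hn hsan hx⟩
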